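/- Let $(a)_0=1$ and $(a)_r=a(a+1)\cdots(a+r-1)$, and let ${}_pF_q[a_1,\dots,a_p;\,b_1,\dots,b_q\,|\,z]=\sum_{k\ge0}\frac{(a_1)_k\cdots(a_p)_k}{(b_1)_k\cdots(b_q)_k}\frac{z^k}{k!}$. Let $m,n\in\mathbb{N}_0$ and $d,e,\alpha,\beta\in\mathbb{C}$ with $\Re(e)>\Re(d)>0$. Suppose that no denominator below vanishes, i.e. none of $2\alpha+m$, $2\beta+n$, $\alpha+\frac12$, $\beta+\frac12$, $\alpha+\beta$ lies in $\{0,-1,-2,\dots\}$, $\alpha\ne\frac12$ if $m\ge1$, and $\beta\ne\frac12$ if $n\ge1$. For $b\in\{\beta,\beta+n\}$ and $y\in\{x,-x\}$ define the Kampé de Fériet functions $$F^{1:1;1}_{1:1;1}[\alpha,b\,|\,x,y]=\sum_{p,q\ge0}\frac{(d)_{p+q}(\alpha)_p(b)_q}{(e)_{p+q}(2\alpha+m)_p(2\beta+n)_q}\frac{x^p}{p!}\frac{y^q}{q!},\qquad F^{1:1;1}_{0:1;1}[\alpha,b\,|\,x,y]=\sum_{p,q\ge0}\frac{(d)_{p+q}(\alpha)_p(b)_q}{(2\alpha+m)_p(2\beta+n)_q}\frac{x^p}{p!}\frac{y^q}{q!},$$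 the triple series $$F^{(3)}_{1}(x)=\sum_{p,q,r\ge0}\frac{(d)_{p+q+r}(\alpha)_q(\beta)_r}{(e)_{p+q+r}(2\alpha+m)_q(2\beta+n)_r}\frac{(-x)^p}{p!}\frac{x^q}{q!}\frac{x^r}{r!},\qquad F^{(3)}_{0}(x)=\sum_{p,q,r\ge0}\frac{(d)_{p+q+r}(\alpha)_q(\beta)_r}{(2\alpha+m)_q(2\beta+n)_r}\frac{(-x)^p}{p!}\frac{x^q}{q!}\frac{x^r}{r!},$$ and, for $0\le j\le m$, $0\le k\le n$, the Srivastava functions $$\mathcal S^{1:0;2}_{1:0;3}[j,k\,|\,x]=\sum_{p,q\ge0}\frac{(d+j+k)_{p+2q}}{(e+j+k)_{p+2q}}\,\frac{\left(\frac{\alpha+\beta+j+k}{2}\right)_q\left(\frac{\alpha+\beta+j+k+1}{2}\right)_q}{\left(\alpha+j+\frac12\right)_q\left(\beta+k+\frac12\right)_q(\alpha+\beta+j+k)_q}\,\frac{x^p}{p!}\frac{(x^2/4)^q}{q!},$$ and $\mathcal S^{1:0;2}_{0:0;3}[j,k\,|\,x]$, the same series without the factor $(e+j+k)_{p+2q}$.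 Put $$C_{j,k}=\frac{(d)_{j+k}(-m)_j(-n)_k(2\alpha-1)_j(2\beta-1)_k}{(2\alpha+m)_j(2\beta+n)_k\left(\alpha-\frac12\right)_j\left(\beta-\frac12\right)_k2^{2j+2k}\,j!\,k!}.$$ (1) For all $x\in\mathbb{C}$, all series involved converge absolutely and $$F^{1:1;1}_{1:1;1}[\alpha,\beta\,|\,x,x]=\sum_{j=0}^m\sum_{k=0}^n\frac{C_{j,k}\,x^{j+k}}{(e)_{j+k}}\,\mathcal S^{1:0;2}_{1:0;3}[j,k\,|\,x].$$ (2) For all $x\in\mathbb{C}$, all series involved converge absolutely and $$F^{1:1;1}_{1:1;1}[\alpha,\beta+n\,|\,x,-x]=F^{(3)}_1(x)=\sum_{j=0}^m\sum_{k=0}^n\frac{C_{j,k}\,x^{j+k}}{(e)_{j+k}}\;{}_4F_5\!\left[\begin{array}{c}\frac{\alpha+\beta+j+k}{2},\frac{\alpha+\beta+j+k+1}{2},\frac{d+j+k}{2},\frac{d+j+k+1}{2}\\ \alpha+j+\frac12,\ \beta+k+\frac12,\ \alpha+\beta+j+k,\ \frac{e+j+k}{2},\frac{e+j+k+1}{2}\end{array}\Big|\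 \frac{x^2}{4}\right].$$ (3) If $|x|<\frac12$, all series involved converge absolutely; and for every $x\in\mathbb{C}$ at which they do, $$F^{1:1;1}_{0:1;1}[\alpha,\beta\,|\,x,x]=\sum_{j=0}^m\sum_{k=0}^nC_{j,k}\,x^{j+k}\,\mathcal S^{1:0;2}_{0:0;3}[j,k\,|\,x].$$ (4) In $$F^{1:1;1}_{0:1;1}[\alpha,\beta+n\,|\,x,-x]=F^{(3)}_0(x)=\sum_{j=0}^m\sum_{k=0}^nC_{j,k}\,x^{j+k}\;{}_4F_3\!\left[\begin{array}{c}\frac{\alpha+\beta+j+k}{2},\frac{\alpha+\beta+j+k+1}{2},\frac{d+j+k}{2},\frac{d+j+k+1}{2}\\ \alpha+j+\frac12,\ \beta+k+\frac12,\ \alpha+\beta+j+k\end{array}\Big|\ x^2\right]$$ the double series on the left and the ${}_4F_3$ series converge absolutely if $|x|<\frac12$, and the triple series does if $|x|<\frac13$. The left-hand side equals $F^{(3)}_0(x)$ at every $x\in\mathbb{C}$ at which these two series converge absolutely, and it equals the double sum on the right at every $x\in\mathbb{C}$ at which the left-hand series and the ${}_4F_3$ series converge absolutely. -/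

import Mathlib

open scoped Nat

noncomputable section

/-- The Pochhammer symbol `(a)_n = a (a + 1) ⋯ (a + n - 1)`. -/
def poch (a : ℂ) (n : ℕ) : ℂ := (ascPochhammer ℂ n).eval a

/-- The product `(a₁)_n ⋯ (a_p)_n` over a parameter list (it is `1` for the empty list). -/
def pochList (as : List ℂ) (n : ℕ) : ℂ := (as.map fun a => poch a n).prod

/-- The general term of the generalized hypergeometric series `pFq[a; b | z]`. -/
def pFqTerm (a b : List ℂ) (z : ℂ) (k : ℕ) : ℂ :=
  pochList a k / pochList b k * z ^ k / (k ! : ℂ)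

/-- The generalized hypergeometric function `pFq[a; b | z]`. -/
def pFq (a b : List ℂ) (z : ℂ) : ℂ := ∑' k : ℕ, pFqTerm a b z k

/-- The general term of the Kampé de Fériet double series
`F^{p:q;k}_{l:m;n}[a : b ; c / a' : b' ; c' | x, y]`; `a`, `a'` carry the index sum `r + s`. -/
def kampeDeFerietTerm (a b c a' b' c' : List ℂ) (x y : ℂ) (r : ℕ × ℕ) : ℂ :=
  pochList a (r.1 + r.2) * pochList b r.1 * pochList c r.2 /
      (pochList a' (r.1 + r.2) * pochList b' r.1 * pochList c' r.2) *
    (x ^ r.1 / (r.1 ! : ℂ)) * (y ^ r.2 / (r.2 ! : ℂ))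

/-- The Kampé de Fériet function. -/
def kampeDeFeriet (a b c a' b' c' : List ℂ) (x y : ℂ) : ℂ :=
  ∑' r : ℕ × ℕ, kampeDeFerietTerm a b c a' b' c' x y r

/-- One row `a :: b₁; b₂; b₃ : c₁; c₂; c₃` of parameters of Srivastava's triple series. -/
structure TripleRow where
  a : List ℂ
  b₁ : List ℂ
  b₂ : List ℂ
  b₃ : List ℂ
  c₁ : List ℂ
  c₂ : List ℂ
  c₃ : List ℂ

/-- The product
`(a)_{p+q+r} (b₁)_{p+q} (b₂)_{q+r} (b₃)_{r+p} (c₁)_p (c₂)_q (c₃)_r` of a row. -/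
def TripleRow.poch (R : TripleRow) (p q r : ℕ) : ℂ :=
  pochList R.a (p + q + r) * pochList R.b₁ (p + q) * pochList R.b₂ (q + r) *
    pochList R.b₃ (r + p) * pochList R.c₁ p * pochList R.c₂ q * pochList R.c₃ r

/-- The general term of Srivastava's triple hypergeometric series
`F^{(3)}[U / L | x, y, z]`. -/
def srivastavaF3Term (U L : TripleRow) (x y z : ℂ) (s : ℕ × ℕ × ℕ) : ℂ :=
  U.poch s.1 s.2.1 s.2.2 / L.poch s.1 s.2.1 s.2.2 *
    (x ^ s.1 / (s.1 ! : ℂ)) * (y ^ s.2.1 / (s.2.1 ! : ℂ)) * (z ^ s.2.2 / (s.2.2 ! : ℂ))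

/-- Srivastava's triple hypergeometric function `F^{(3)}`. -/
def srivastavaF3 (U L : TripleRow) (x y z : ℂ) : ℂ :=
  ∑' s : ℕ × ℕ × ℕ, srivastavaF3Term U L x y z s

/-- The product of `(a)_{pθ + qφ}` over a list of weighted parameters `[a : θ, φ]`. -/
def pochList₂ (as : List (ℂ × ℕ × ℕ)) (p q : ℕ) : ℂ :=
  (as.map fun a => poch a.1 (p * a.2.1 + q * a.2.2)).prod

/-- The general term of the Srivastava–Daoust double series
`S^{A:B;B'}_{C:D;D'}[[a : θ, φ] : b ; b' / [c : θ', φ'] : d ; d' | x, y]`, where the weights of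
the parameters in `b, b', d, d'` are equal to `1`, as is understood when none are written. -/
def srivastavaDaoustTerm (a : List (ℂ × ℕ × ℕ)) (b b' : List ℂ)
    (c : List (ℂ × ℕ × ℕ)) (d d' : List ℂ) (x y : ℂ) (r : ℕ × ℕ) : ℂ :=
  pochList₂ a r.1 r.2 * pochList b r.1 * pochList b' r.2 /
      (pochList₂ c r.1 r.2 * pochList d r.1 * pochList d' r.2) *
    (x ^ r.1 / (r.1 ! : ℂ)) * (y ^ r.2 / (r.2 ! : ℂ))

/-- The Srivastava–Daoust double hypergeometric function. -/
def srivastavaDaoust (a : List (ℂ × ℕ × ℕ)) (b b' : List ℂ)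
    (c : List (ℂ × ℕ × ℕ)) (d d' : List ℂ) (x y : ℂ) : ℂ :=
  ∑' r : ℕ × ℕ, srivastavaDaoustTerm a b b' c d d' x y r

end

noncomputable section

open PowerSeries Filter Topology

/-! Take the weights W_N = (d)_N / (e)_N, or W_N = (d)_N when `e` is absent. Each multiple series is
then ∑ W_N [X^N]A x^N for a product A of Kummer, exponential and even series, before terms of equal
total degree are collected. Absolute convergence justifies collecting them, so each formula follows
from an identity of formal power series, at every point where the series involved converge
absolutely.

The formal identity is `kummerSeries_mul_kummerSeries`. Each factor ₁F₁[a; 2a+m | X] is e^{X/2}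
times a finite combination of X^j ₀F₁[a+j+1/2 | X²/16] (`kummerSeries_expansion`): Kummer's second
transformation is the case m = 0, and a contiguous relation raises m. By Chu–Vandermonde, two ₀F₁
multiply to a ₂F₃ (`besselSeries_mul_besselSeries`), and the two exponentials combine to e^X.

For the arguments x, -x, Kummer's first transformation gives e^{-X} ₁F₁[β; 2β+n | X] = ₁F₁[β+n; 2β+n
| -X], which cancels e^X. Keeping e^{-X} as a third factor produces the triple series. Finally, a
factor X^s shifts the parameters of the weight, because (d)_{s+N} = (d)_s (d+s)_N. -/

/-! ### Pochhammer symbols -/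

lemma poch_zero (a : ℂ) : poch a 0 = 1 := by simp [poch]

lemma poch_succ (a : ℂ) (n : ℕ) : poch a (n + 1) = poch a n * (a + n) := by
  simp [poch, ascPochhammer_succ_eval]

lemma poch_succ_left (a : ℂ) (n : ℕ) : poch a (n + 1) = a * poch (a + 1) n := by
  simp [poch, ascPochhammer_succ_left]

lemma poch_add (a : ℂ) (n k : ℕ) : poch a (n + k) = poch a n * poch (a + n) k := by
  induction k with
  | zero => simp [poch_zero]
  | succ k ih => rw [← add_assoc, poch_succ, ih, poch_succ]; push_cast; ring

lemma poch_ne_zero {a : ℂ} (h : ∀ i : ℕ, a ≠ -(i : ℂ)) (n : ℕ) : poch a n ≠ 0 := by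
  induction n with
  | zero => simp [poch_zero]
  | succ n ih =>
    rw [poch_succ]
    exact mul_ne_zero ih fun h' => h n (eq_neg_of_add_eq_zero_left h')

lemma poch_two_mul (s : ℂ) (q : ℕ) :
    poch s (2 * q) = 4 ^ q * poch (s / 2) q * poch ((s + 1) / 2) q := by
  induction q with
  | zero => simp [poch_zero]
  | succ q ih =>
    rw [show 2 * (q + 1) = 2 * q + 1 + 1 by ring, poch_succ, poch_succ, ih, poch_succ, poch_succ]
    push_cast; ring

lemma poch_one (n : ℕ) : poch 1 n = (n ! : ℂ) := by
  simp [poch]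

lemma poch_neg_natCast_succ (m : ℕ) : poch (-m) (m + 1) = 0 := by
  rw [poch_succ]; simp

lemma continuous_poch (n : ℕ) : Continuous fun a : ℂ => poch a n :=
  (ascPochhammer ℂ n).continuous

lemma factorial_ne_zero' (n : ℕ) : (n ! : ℂ) ≠ 0 := by exact_mod_cast n.factorial_ne_zero

lemma ne_neg_natCast_add {a : ℂ} (h : ∀ i : ℕ, a ≠ -(i : ℂ)) (k i : ℕ) :
    a + k ≠ -(i : ℂ) := by
  intro h'
  apply h (k + i)
  push_cast
  linear_combination h'

/-! ### Formal series and their differential equations -/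

/-- The even power series `∑ a q X ^ (2 q)`. -/
def evenSeries (a : ℕ → ℂ) : ℂ⟦X⟧ := PowerSeries.mk fun l => if Even l then a (l / 2) else 0

lemma coeff_evenSeries_two_mul (a : ℕ → ℂ) (q : ℕ) : coeff (2 * q) (evenSeries a) = a q := by
  simp [evenSeries]

lemma coeff_evenSeries_two_mul_add_one (a : ℕ → ℂ) (q : ℕ) :
    coeff (2 * q + 1) (evenSeries a) = 0 := by
  simp [evenSeries]

lemma coeff_evenSeries_of_not_even (a : ℕ → ℂ) {l : ℕ} (h : ¬ Even l) :
    coeff l (evenSeries a) = 0 := by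
  simp [evenSeries, h]

/-- The formal confluent hypergeometric series `₁F₁[a; c | X]`. -/
def kummerSeries (a c : ℂ) : ℂ⟦X⟧ := PowerSeries.mk fun k => poch a k / (poch c k * (k ! : ℂ))

/-- The formal series `₀F₁[c | X ^ 2 / 16]`. -/
def besselSeries (c : ℂ) : ℂ⟦X⟧ := evenSeries fun q => 1 / (poch c q * 16 ^ q * (q ! : ℂ))

/-- The coefficient of `X ^ (2 q)` in `₂F₃[s / 2, (s + 1) / 2; a, b, s | X ^ 2 / 4]`. -/
def besselProdCoeff (a b s : ℂ) (q : ℕ) : ℂ :=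
  poch (s / 2) q * poch ((s + 1) / 2) q / (poch a q * poch b q * poch s q) / (4 ^ q * (q ! : ℂ))

/-- The formal series `₂F₃[s / 2, (s + 1) / 2; a, b, s | X ^ 2 / 4]`. -/
def besselProdSeries (a b s : ℂ) : ℂ⟦X⟧ := evenSeries (besselProdCoeff a b s)

lemma coeff_kummerSeries (a c : ℂ) (k : ℕ) :
    coeff k (kummerSeries a c) = poch a k / (poch c k * (k ! : ℂ)) := by
  simp [kummerSeries]

lemma coeff_kummerSeries_succ {a c : ℂ} (hc : ∀ i : ℕ, c ≠ -(i : ℂ)) (k : ℕ) :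
    coeff (k + 1) (kummerSeries a c) * ((k + 1) * (c + k)) =
      (a + k) * coeff k (kummerSeries a c) := by
  have h1 := poch_ne_zero hc k
  have h2 : c + k ≠ 0 := fun h' => hc k (eq_neg_of_add_eq_zero_left h')
  have h3 := factorial_ne_zero' k
  have h4 : (k : ℂ) + 1 ≠ 0 := by exact_mod_cast k.succ_ne_zero
  rw [coeff_kummerSeries, coeff_kummerSeries, poch_succ, poch_succ, Nat.factorial_succ]
  push_cast
  field_simp

/-- Uniqueness of the power series solution of Kummer's differential equation. -/
lemma eq_kummerSeries_of_ode {a c : ℂ} (hc : ∀ i : ℕ, c ≠ -(i : ℂ)) {y : ℂ⟦X⟧}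
    (h0 : coeff 0 y = 1)
    (hy : X * d⁄dX ℂ (d⁄dX ℂ y) + C c * d⁄dX ℂ y - X * d⁄dX ℂ y - C a * y = 0) :
    y = kummerSeries a c := by
  ext k
  induction k with
  | zero => rw [h0]; simp [coeff_kummerSeries, poch_zero]
  | succ k ih =>
    have h2 : c + k ≠ 0 := fun h' => hc k (eq_neg_of_add_eq_zero_left h')
    have h4 : (k : ℂ) + 1 ≠ 0 := by exact_mod_cast k.succ_ne_zero
    apply mul_right_cancel₀ (mul_ne_zero h4 h2)
    rw [coeff_kummerSeries_succ hc, ← ih]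
    have := congrArg (coeff k) hy
    -- Multiplication by `X` shifts coefficients, so the constant coefficient is treated separately.
    rcases k with _ | k
    · simp [coeff_derivative, coeff_C_mul, -coeff_zero_eq_constantCoeff, coeff_zero_X_mul] at this
      simp only [Nat.cast_zero, zero_add, add_zero]
      linear_combination this
    · simp [coeff_derivative, coeff_C_mul, coeff_succ_X_mul] at this
      push_cast
      linear_combination this

/-- Kummer's equation after the substitution X ↦ -X, in the form needed for the first
transformation. -/
lemma rescale_kummerSeries_ode {a c : ℂ} (hc : ∀ i : ℕ, c ≠ -(i : ℂ)) :
    X * d⁄dX ℂ (d⁄dX ℂ (rescale (-1) (kummerSeries a c))) +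
      C c * d⁄dX ℂ (rescale (-1) (kummerSeries a c)) +
      X * d⁄dX ℂ (rescale (-1) (kummerSeries a c)) +
      C a * rescale (-1) (kummerSeries a c) = 0 := by
  ext k
  have := coeff_kummerSeries_succ (a := a) hc k
  rcases k with _ | k
  · simp [coeff_derivative, coeff_C_mul, -coeff_zero_eq_constantCoeff, coeff_zero_X_mul,
      coeff_rescale] at this ⊢
    linear_combination -this
  · simp [coeff_derivative, coeff_C_mul, coeff_succ_X_mul, coeff_rescale] at this ⊢
    linear_combination (-1) ^ (k + 2) * this

lemma besselSeries_ode {c : ℂ} (hc : ∀ i : ℕ, c ≠ -(i : ℂ)) :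
    X * d⁄dX ℂ (d⁄dX ℂ (besselSeries c)) + C (2 * c - 1) * d⁄dX ℂ (besselSeries c) -
      C (1 / 4) * X * besselSeries c = 0 := by
  -- Hiding 2c - 1 behind `t` keeps `C t` in one piece when `map_sub` is used below.
  obtain ⟨t, ht⟩ : ∃ t, t = 2 * c - 1 := ⟨_, rfl⟩
  rw [← ht]
  ext k
  rcases k with _ | k
  · have : coeff 1 (besselSeries c) = 0 := coeff_evenSeries_two_mul_add_one _ 0
    simp [coeff_derivative, coeff_C_mul, -coeff_zero_eq_constantCoeff, coeff_zero_X_mul,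
      mul_assoc, this]
  · simp only [map_sub, map_add, mul_assoc, coeff_succ_X_mul, coeff_C_mul, coeff_derivative,
      map_zero]
    -- Even `k` gives the recurrence of the ₀F₁ coefficients; for odd `k` every term vanishes.
    rcases Nat.even_or_odd' k with ⟨q, rfl | rfl⟩
    · rw [besselSeries, show 2 * q + 1 + 1 = 2 * (q + 1) by ring, coeff_evenSeries_two_mul,
        coeff_evenSeries_two_mul]
      have h1 := poch_ne_zero hc q
      have h2 : c + q ≠ 0 := fun h' => hc q (eq_neg_of_add_eq_zero_left h')
      have h3 := factorial_ne_zero' q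
      have h4 : (q : ℂ) + 1 ≠ 0 := by exact_mod_cast q.succ_ne_zero
      rw [poch_succ, Nat.factorial_succ]
      push_cast
      rw [ht]
      field_simp
      ring
    · rw [besselSeries, show 2 * q + 1 + 1 + 1 = 2 * (q + 1) + 1 by ring,
        coeff_evenSeries_two_mul_add_one, coeff_evenSeries_two_mul_add_one]
      simp

/-! ### Kummer's two transformations -/

lemma derivative_rescale_exp (s : ℂ) :
    d⁄dX ℂ (rescale s (exp ℂ)) = C s * rescale s (exp ℂ) := by
  ext k
  have h3 := factorial_ne_zero' k
  have h4 : (k : ℂ) + 1 ≠ 0 := by exact_mod_cast k.succ_ne_zero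
  simp [coeff_derivative, coeff_rescale, coeff_exp, coeff_C_mul, Nat.factorial_succ]
  field_simp
  ring

/-- Kummer's first transformation. -/
lemma kummerSeries_eq_exp_mul_rescale {a c : ℂ} (hc : ∀ i : ℕ, c ≠ -(i : ℂ)) :
    kummerSeries a c = exp ℂ * rescale (-1) (kummerSeries (c - a) c) := by
  symm
  apply eq_kummerSeries_of_ode hc
  · simp [coeff_mul, coeff_rescale, coeff_kummerSeries, poch_zero,
      -coeff_zero_eq_constantCoeff]
  · have h := rescale_kummerSeries_ode (a := c - a) hc
    have hE : d⁄dX ℂ (exp ℂ) = exp ℂ := derivative_exp ℂ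
    set w := rescale (-1) (kummerSeries (c - a) c)
    simp only [Derivation.leibniz, smul_eq_mul, hE, map_add, map_sub] at h ⊢
    -- Inserting e^X w into Kummer's equation leaves e^X times the reflected equation for w.
    linear_combination exp ℂ * h

/-- Kummer's second transformation. -/
lemma kummerSeries_two_mul {a : ℂ} (hc : ∀ i : ℕ, 2 * a ≠ -(i : ℂ))
    (ha : ∀ i : ℕ, a + 1 / 2 ≠ -(i : ℂ)) :
    kummerSeries a (2 * a) = rescale (1 / 2) (exp ℂ) * besselSeries (a + 1 / 2) := by
  symm
  apply eq_kummerSeries_of_ode hc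
  · simp [coeff_mul, coeff_rescale, besselSeries, evenSeries, poch_zero,
      -coeff_zero_eq_constantCoeff]
  · have h := besselSeries_ode ha
    have hE := derivative_rescale_exp (1 / 2)
    rw [show 2 * (a + 1 / 2) - 1 = 2 * a by ring] at h
    have e1 : (C (1 / 4) : ℂ⟦X⟧) = C (1 / 2) * C (1 / 2) := by rw [← map_mul]; norm_num
    -- `C (1 / 2)` is an opaque atom for `ring`; this relation supplies its value.
    have e2 : (2 * C (1 / 2) : ℂ⟦X⟧) = 1 := by
      rw [show (2 : ℂ⟦X⟧) = C 2 from (map_ofNat C 2).symm, ← map_mul]; norm_num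
    have e3 : (C 2 : ℂ⟦X⟧) = 2 := map_ofNat C 2
    set E := rescale (1 / 2 : ℂ) (exp ℂ)
    set g := besselSeries (a + 1 / 2)
    have hE2 : d⁄dX ℂ (C (1 / 2 : ℂ)) = 0 := derivative_C
    simp only [Derivation.leibniz, smul_eq_mul, hE, hE2, map_add, map_mul, e1, e3] at h ⊢
    linear_combination E * h + (X * E * d⁄dX ℂ g + C a * E * g + X * C (1 / 2) * E * g) * e2

/-! ### Product of two ₀F₁ series -/

lemma evenSeries_mul (f g : ℕ → ℂ) :
    evenSeries f * evenSeries g =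
      evenSeries fun q => ∑ p ∈ Finset.HasAntidiagonal.antidiagonal q, f p.1 * g p.2 := by
  ext l
  rw [coeff_mul]
  rcases Nat.even_or_odd' l with ⟨q, rfl | rfl⟩
  · rw [coeff_evenSeries_two_mul]
    symm
    apply Finset.sum_of_injOn (fun p : ℕ × ℕ => (2 * p.1, 2 * p.2))
    · rintro ⟨a, b⟩ - ⟨c, d⟩ - h
      simp only [Prod.mk.injEq] at h ⊢
      omega
    · rintro ⟨a, b⟩ h
      simp only [Finset.mem_coe, Finset.HasAntidiagonal.mem_antidiagonal] at h ⊢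
      omega
    · rintro ⟨a, b⟩ h h'
      simp only [Finset.mem_coe, Finset.HasAntidiagonal.mem_antidiagonal, Set.mem_image,
        Prod.mk.injEq, Prod.exists, not_exists, not_and] at h h'
      by_cases ha : Even a
      · obtain ⟨c, rfl⟩ := ha
        obtain ⟨d, rfl⟩ : Even b := by
          by_contra hb
          rw [Nat.not_even_iff_odd] at hb
          obtain ⟨d, rfl⟩ := hb
          omega
        have := h' c d (by omega) (by omega)
        omega
      · rw [coeff_evenSeries_of_not_even _ ha, zero_mul]
    · rintro ⟨a, b⟩ -
      simp only [coeff_evenSeries_two_mul]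
  · rw [coeff_evenSeries_two_mul_add_one]
    apply Finset.sum_eq_zero
    rintro ⟨a, b⟩ h
    rw [Finset.HasAntidiagonal.mem_antidiagonal] at h
    by_cases ha : Even a
    · have hb : ¬ Even b := fun hb => by
        have := ha.add hb
        rw [h] at this
        exact Nat.not_even_bit1 q this
      rw [coeff_evenSeries_of_not_even _ hb, mul_zero]
    · rw [coeff_evenSeries_of_not_even _ ha, zero_mul]

lemma descPochhammer_smeval_eq_poch (r : ℂ) (n : ℕ) :
    (descPochhammer ℤ n).smeval r = poch (r - n + 1) n := by
  rw [Polynomial.descPochhammer_smeval_eq_ascPochhammer,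
    Polynomial.ascPochhammer_smeval_eq_eval]
  rfl

/-- A form of the Chu–Vandermonde identity. -/
lemma sum_choose_mul_poch_mul_poch (a b : ℂ) (n : ℕ) :
    ∑ p ∈ Finset.HasAntidiagonal.antidiagonal n,
        (n.choose p.1 : ℂ) * (poch (a + p.1) p.2 * poch (b + p.2) p.1) =
      poch (a + b - 1 + n) n := by
  -- Vandermonde for falling factorials; with p + p' = n, the choice r = b + n - 1 makes the lowest
  -- factor r - p + 1 equal to b + p', and likewise for s.
  have h := Ring.descPochhammer_smeval_add (r := b + n - 1) (s := a + n - 1) n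
    (Commute.all _ _)
  simp only [descPochhammer_smeval_eq_poch] at h
  rw [show b + n - 1 + (a + n - 1) - n + 1 = a + b - 1 + n by ring] at h
  rw [h]
  refine Finset.sum_congr rfl fun p hp => ?_
  rw [Finset.HasAntidiagonal.mem_antidiagonal] at hp
  have hp' : (n : ℂ) = p.1 + p.2 := by rw [← hp]; push_cast; rfl
  rw [hp', show b + (p.1 + p.2) - 1 - p.1 + 1 = b + (p.2 : ℂ) by ring,
    show a + (p.1 + p.2) - 1 - p.2 + 1 = a + (p.1 : ℂ) by ring, mul_comm (poch (a + p.1) p.2)]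

/-- The product of two `₀F₁` series is a `₂F₃` series. -/
lemma besselSeries_mul_besselSeries {a b s : ℂ} (ha : ∀ i : ℕ, a ≠ -(i : ℂ))
    (hb : ∀ i : ℕ, b ≠ -(i : ℂ)) (hs : ∀ i : ℕ, s ≠ -(i : ℂ)) (hab : s = a + b - 1) :
    besselSeries a * besselSeries b = besselProdSeries a b s := by
  rw [besselSeries, besselSeries, evenSeries_mul, besselProdSeries]
  congr 1
  ext q
  rw [besselProdCoeff]
  -- By duplication both sides are (s)_{2q} / 4^q. Since s = a + b - 1, the factor (s+q)_q is the
  -- Chu–Vandermonde sum.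
  have e1 : poch (s / 2) q * poch ((s + 1) / 2) q = poch s q * poch (s + q) q / 4 ^ q := by
    rw [← poch_add, ← two_mul, poch_two_mul]
    field_simp
  have h1 := poch_ne_zero ha q
  have h2 := poch_ne_zero hb q
  have h3 := poch_ne_zero hs q
  have h4 := factorial_ne_zero' q
  rw [e1, hab, ← sum_choose_mul_poch_mul_poch, ← hab]
  rw [Finset.mul_sum, Finset.sum_div, Finset.sum_div, Finset.sum_div]
  refine Finset.sum_congr rfl fun p hp => ?_
  rw [Finset.HasAntidiagonal.mem_antidiagonal] at hp
  have g1 : poch a q = poch a p.1 * poch (a + p.1) p.2 := by rw [← hp, poch_add]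
  have g2 : poch b q = poch b p.2 * poch (b + p.2) p.1 := by
    rw [← hp, add_comm p.1, poch_add]
  have g3 : (q ! : ℂ) = q.choose p.1 * p.1 ! * p.2 ! := by
    rw [← hp, ← Nat.add_choose_mul_factorial_mul_factorial, ← Nat.choose_symm_add]; push_cast; rfl
  have g4 : (16 : ℂ) ^ p.1 * 16 ^ p.2 = 4 ^ q * 4 ^ q := by
    rw [← pow_add, hp, ← mul_pow]; norm_num
  have k1 := factorial_ne_zero' p.1
  have k2 := factorial_ne_zero' p.2
  have k3 : (q.choose p.1 : ℂ) ≠ 0 := by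
    intro h; rw [h] at g3; simp at g3; exact h4 (by exact_mod_cast g3)
  rw [g1] at h1
  rw [g2] at h2
  obtain ⟨m1, m2⟩ := mul_ne_zero_iff.1 h1
  obtain ⟨m3, m4⟩ := mul_ne_zero_iff.1 h2
  rw [g1, g2, g3]
  trans 1 / (poch a p.1 * poch b p.2 * (p.1 ! : ℂ) * (p.2 ! : ℂ) * ((16 : ℂ) ^ p.1 * 16 ^ p.2))
  · field_simp
  · rw [g4]; field_simp

/-! ### Expansion of ₁F₁[a; 2a + m] in Bessel functions -/

/-- The coefficients in the expansion of `exp (-x / 2) * ₁F₁[a; 2 a + m | x]`. -/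
def kummerBesselCoeff (m : ℕ) (a : ℂ) (j : ℕ) : ℂ :=
  poch (-m) j * poch (2 * a - 1) j /
    (poch (2 * a + m) j * poch (a - 1 / 2) j * 4 ^ j * (j ! : ℂ))

/-- Coefficientwise this is 1/(c)_k - 1/(c+1)_k = k/(c)_{k+1}. For c = 2a + m the last series has
parameters a + 1 and 2(a+1) + m, so both terms on the right belong to the same `m`. -/
lemma kummerSeries_contiguous {a c : ℂ} (hc : ∀ i : ℕ, c ≠ -(i : ℂ)) :
    kummerSeries a (c + 1) =
      kummerSeries a c - C (a / (c * (c + 1))) * (X * kummerSeries (a + 1) (c + 2)) := by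
  ext k
  have c0 : c ≠ 0 := by simpa using hc 0
  have c1 : c + 1 ≠ 0 := fun h => hc 1 (by rw [eq_neg_of_add_eq_zero_left h]; simp)
  rcases k with _ | k
  · simp [coeff_C_mul, -coeff_zero_eq_constantCoeff, coeff_zero_X_mul, coeff_kummerSeries,
      poch_zero]
  · simp only [map_sub, coeff_C_mul, coeff_succ_X_mul, coeff_kummerSeries]
    have hc2 : ∀ i : ℕ, c + 2 ≠ -(i : ℂ) := by exact_mod_cast ne_neg_natCast_add hc 2
    have h1 := poch_ne_zero hc2 k
    have h3 := factorial_ne_zero' k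
    have h4 : (k : ℂ) + 1 ≠ 0 := by exact_mod_cast k.succ_ne_zero
    have h5 : c + 1 + k ≠ 0 := by
      have := poch_ne_zero hc (k + 2)
      rw [poch_succ] at this
      have := (mul_ne_zero_iff.1 this).2
      push_cast at this
      intro h; apply this; linear_combination h
    have e1 : poch (c + 1) (k + 1) = (c + 1) * poch (c + 2) k := by
      rw [poch_succ_left]; congr 2; ring
    have e2 : poch c (k + 1) * (c + 1 + k) = c * ((c + 1) * poch (c + 2) k) := by
      have := poch_succ c (k + 1)
      rw [poch_succ_left, e1] at this
      rw [this]; push_cast; ring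
    have e3 : poch c (k + 1) = c * ((c + 1) * poch (c + 2) k) / (c + 1 + k) := by
      rw [← e2]; field_simp
    rw [e1, e3, poch_succ_left, Nat.factorial_succ]
    push_cast
    field_simp
    ring

lemma kummerBesselCoeff_zero (m : ℕ) (a : ℂ) : kummerBesselCoeff m a 0 = 1 := by
  simp [kummerBesselCoeff, poch_zero]

lemma kummerBesselCoeff_self_succ (m : ℕ) (a : ℂ) : kummerBesselCoeff m a (m + 1) = 0 := by
  simp [kummerBesselCoeff, poch_neg_natCast_succ]

/-- The contiguous relation read on the expansion coefficients. Requiring 2a to be a non-integer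
keeps all denominators nonzero, also for the shifted parameter a + 1. -/
lemma kummerBesselCoeff_succ {a : ℂ} (ha : ∀ z : ℤ, 2 * a ≠ z) (m j : ℕ) :
    kummerBesselCoeff (m + 1) a (j + 1) = kummerBesselCoeff m a (j + 1) -
      a / ((2 * a + m) * (2 * a + m + 1)) * kummerBesselCoeff m (a + 1) j := by
  have hc : ∀ i : ℕ, 2 * a + m ≠ -(i : ℂ) := fun i h => ha (-i - m) (by
    push_cast; linear_combination h)
  have hh : ∀ i : ℕ, a + 1 / 2 ≠ -(i : ℂ) := fun i h => ha (-2 * i - 1) (by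
    push_cast; linear_combination 2 * h)
  have hh' : a - 1 / 2 ≠ 0 := fun h => ha 1 (by push_cast; linear_combination 2 * h)
  have hc2 : ∀ i : ℕ, 2 * a + m + 2 ≠ -(i : ℂ) := by exact_mod_cast ne_neg_natCast_add hc 2
  have c0 : 2 * a + m ≠ 0 := by simpa using hc 0
  have c1 : 2 * a + m + 1 ≠ 0 := fun h => hc 1 (by rw [eq_neg_of_add_eq_zero_left h]; simp)
  have h1 := poch_ne_zero hc2 j
  have h2 := poch_ne_zero hh j
  have h3 := factorial_ne_zero' j
  have h4 : (j : ℂ) + 1 ≠ 0 := by exact_mod_cast j.succ_ne_zero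
  have h5 : 2 * a + m + 1 + j ≠ 0 := by
    intro h; apply hc (1 + j); push_cast; linear_combination h
  have e1 : poch (2 * a + m + 1) (j + 1) = (2 * a + m + 1) * poch (2 * a + m + 2) j := by
    rw [poch_succ_left]; congr 2; ring
  have e2 : poch (2 * a + m) (j + 1) =
      (2 * a + m) * ((2 * a + m + 1) * poch (2 * a + m + 2) j) / (2 * a + m + 1 + j) := by
    have := poch_succ (2 * a + m) (j + 1)
    rw [poch_succ_left, e1] at this
    rw [this]; push_cast; field_simp; ring
  have e3 : poch (-m - 1) (j + 1) = (-m - 1) * poch (-m) j := by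
    rw [poch_succ_left]; congr 2; ring
  have e4 : poch (a - 1 / 2) (j + 1) = (a - 1 / 2) * poch (a + 1 / 2) j := by
    rw [poch_succ_left]; congr 2; ring
  have e5 : poch (2 * a - 1) (j + 1) = (2 * a - 1) * poch (2 * a) j := by
    rw [poch_succ_left]; congr 2; ring
  have e6 : 2 * a * poch (2 * a + 1) j = poch (2 * a) j * (2 * a + j) := by
    rw [← poch_succ_left, poch_succ]
  have a0 : a ≠ 0 := by rintro rfl; exact ha 0 (by simp)
  have e7 : poch (2 * a + 1) j = poch (2 * a) j * (2 * a + j) / (2 * a) := by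
    rw [← e6]; field_simp
  rw [kummerBesselCoeff, kummerBesselCoeff, kummerBesselCoeff]
  rw [show (-((m + 1 : ℕ) : ℂ)) = -m - 1 by push_cast; ring,
    show 2 * a + ((m + 1 : ℕ) : ℂ) = 2 * a + m + 1 by push_cast; ring,
    show 2 * (a + 1) - 1 = 2 * a + 1 by ring, show 2 * (a + 1) + (m : ℂ) = 2 * a + m + 2 by ring,
    show a + 1 - 1 / 2 = a + 1 / 2 by ring, e1, e2, e3, e4, e5, e7, poch_succ, Nat.factorial_succ,
    pow_succ, show a - 1 / 2 = (2 * a - 1) / 2 by ring]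
  have h6 : 2 * a - 1 ≠ 0 := by intro h; apply hh'; linear_combination h / 2
  push_cast
  field_simp
  ring

/-- Induction on `m` descends to 2a + m', m' < m, where the final hypotheses allow zero
denominators. The condition on 2a excludes them and is invariant under a ↦ a + 1; the other
parameters are reached by continuity. -/
lemma kummerSeries_expansion_generic (m : ℕ) {a : ℂ} (ha : ∀ z : ℤ, 2 * a ≠ z) :
    kummerSeries a (2 * a + m) = rescale (1 / 2) (exp ℂ) *
      ∑ j ∈ Finset.range (m + 1),
        C (kummerBesselCoeff m a j) * (X ^ j * besselSeries (a + j + 1 / 2)) := by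
  induction m generalizing a with
  | zero =>
    rw [Nat.cast_zero, add_zero, kummerSeries_two_mul]
    · simp [kummerBesselCoeff_zero]
    · exact fun i h => ha (-i) (by push_cast; exact h)
    · exact fun i h => ha (-2 * i - 1) (by push_cast; linear_combination 2 * h)
  | succ m ih =>
    have hc : ∀ i : ℕ, 2 * a + m ≠ -(i : ℂ) := fun i h => ha (-i - m) (by
      push_cast; linear_combination h)
    have ha' : ∀ z : ℤ, 2 * (a + 1) ≠ z := fun z h => ha (z - 2) (by
      push_cast; linear_combination h)
    have e : 2 * a + m + 2 = 2 * (a + 1) + (m : ℂ) := by ring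
    -- The sum is padded by the term j = m + 1, which vanishes since (-m)_{m+1} = 0, and its term j
    -- = 0 is split off.
    have hS : ∑ j ∈ Finset.range (m + 1),
          C (kummerBesselCoeff m a j) * (X ^ j * besselSeries (a + j + 1 / 2)) =
        ∑ j ∈ Finset.range (m + 1), C (kummerBesselCoeff m a (j + 1)) *
            (X ^ (j + 1) * besselSeries (a + ((j + 1 : ℕ) : ℂ) + 1 / 2)) +
          besselSeries (a + 1 / 2) := by
      have h1 := Finset.sum_range_succ
        (fun j => C (kummerBesselCoeff m a j) * (X ^ j * besselSeries (a + j + 1 / 2))) (m + 1)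
      rw [Finset.sum_range_succ' _ (m + 1), kummerBesselCoeff_self_succ] at h1
      simpa [kummerBesselCoeff_zero] using h1.symm
    rw [show 2 * a + ((m + 1 : ℕ) : ℂ) = 2 * a + m + 1 by push_cast; ring,
      kummerSeries_contiguous hc, e, ih ha, ih ha', hS, Finset.sum_range_succ' _ (m + 1)]
    simp only [kummerBesselCoeff_succ ha, map_sub, map_mul, sub_mul, Finset.sum_sub_distrib]
    have : ∀ j : ℕ, besselSeries (a + ((j + 1 : ℕ) : ℂ) + 1 / 2) =
        besselSeries (a + 1 + j + 1 / 2) := fun j => by congr 1; push_cast; ring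
    have e2 : ∑ j ∈ Finset.range (m + 1),
          C (a / ((2 * a + m) * (2 * a + m + 1))) * C (kummerBesselCoeff m (a + 1) j) *
            (X ^ (j + 1) * besselSeries (a + 1 + j + 1 / 2)) =
        C (a / ((2 * a + m) * (2 * a + m + 1))) * X * ∑ j ∈ Finset.range (m + 1),
          C (kummerBesselCoeff m (a + 1) j) * (X ^ j * besselSeries (a + 1 + j + 1 / 2)) := by
      rw [Finset.mul_sum]
      exact Finset.sum_congr rfl fun j _ => by ring
    simp only [this, e2, kummerBesselCoeff_zero, Nat.cast_zero, pow_zero, map_one, one_mul,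
      add_zero]
    ring

lemma mem_closure_two_mul_ne_intCast (a : ℂ) : a ∈ closure {b : ℂ | ∀ z : ℤ, 2 * b ≠ z} := by
  have : (Set.range fun z : ℤ => (z : ℂ) / 2).Countable := Set.countable_range _
  have h := this.dense_compl ℝ
  have := h a
  refine closure_mono ?_ this
  intro b hb z hz
  exact hb ⟨z, by simp [← hz]⟩

lemma continuousAt_kummerBesselCoeff {m j : ℕ} (hj : j ≤ m) {a : ℂ}
    (hc : ∀ i : ℕ, 2 * a + m ≠ -(i : ℂ)) (ha : ∀ i : ℕ, a + 1 / 2 ≠ -(i : ℂ))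
    (h0 : m ≠ 0 → a ≠ 1 / 2) : ContinuousAt (fun b => kummerBesselCoeff m b j) a := by
  have h : poch (a - 1 / 2) j ≠ 0 := by
    -- The factor a - 1/2 occurs only for j ≥ 1, which forces m ≥ 1.
    rcases j with _ | j
    · simp [poch_zero]
    · rw [poch_succ_left]
      refine mul_ne_zero (sub_ne_zero.2 (h0 (by omega))) (poch_ne_zero (fun i => ?_) j)
      rw [show a - 1 / 2 + 1 = a + 1 / 2 by ring]
      exact ha i
  have h1 := poch_ne_zero hc j
  have h3 := factorial_ne_zero' j
  have hp : ∀ {f : ℂ → ℂ}, Continuous f → Continuous fun b => poch (f b) j :=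
    fun hf => (continuous_poch j).comp hf
  unfold kummerBesselCoeff
  refine ContinuousAt.div ?_ ?_ (mul_ne_zero (mul_ne_zero (mul_ne_zero h1 h) (by simp)) h3)
  · exact (continuous_const.mul (hp (by fun_prop))).continuousAt
  · exact ((((hp (by fun_prop)).mul (hp (by fun_prop))).mul continuous_const).mul
      continuous_const).continuousAt

lemma continuousAt_coeff_besselSeries {c : ℂ} (hc : ∀ i : ℕ, c ≠ -(i : ℂ)) (k : ℕ) :
    ContinuousAt (fun b => coeff k (besselSeries b)) c := by
  rcases Nat.even_or_odd' k with ⟨q, rfl | rfl⟩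
  · simp only [besselSeries, coeff_evenSeries_two_mul]
    have h1 := poch_ne_zero hc q
    have h3 := factorial_ne_zero' q
    refine ContinuousAt.div continuousAt_const ?_ (mul_ne_zero (mul_ne_zero h1 (by simp)) h3)
    exact (((continuous_poch q).mul continuous_const).mul continuous_const).continuousAt
  · simp only [besselSeries, coeff_evenSeries_two_mul_add_one]
    exact continuousAt_const

/-- The expansion of `₁F₁[a; 2 a + m | x]` in Bessel functions. -/
lemma kummerSeries_expansion (m : ℕ) {a : ℂ}
    (hc : ∀ i : ℕ, 2 * a + m ≠ -(i : ℂ)) (ha : ∀ i : ℕ, a + 1 / 2 ≠ -(i : ℂ))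
    (h0 : m ≠ 0 → a ≠ 1 / 2) :
    kummerSeries a (2 * a + m) = rescale (1 / 2) (exp ℂ) *
      ∑ j ∈ Finset.range (m + 1),
        C (kummerBesselCoeff m a j) * (X ^ j * besselSeries (a + j + 1 / 2)) := by
  ext k
  have hne : (nhdsWithin a {b : ℂ | ∀ z : ℤ, 2 * b ≠ z}).NeBot :=
    mem_closure_iff_nhdsWithin_neBot.1 (mem_closure_two_mul_ne_intCast a)
  have hL : ContinuousAt (fun b => coeff k (kummerSeries b (2 * b + m))) a := by
    simp only [coeff_kummerSeries]
    have h1 := poch_ne_zero hc k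
    have h3 := factorial_ne_zero' k
    refine ContinuousAt.div (continuous_poch k).continuousAt ?_ (mul_ne_zero h1 h3)
    exact (((continuous_poch k).comp (by fun_prop)).mul continuous_const).continuousAt
  have hR : ContinuousAt (fun b => coeff k (rescale (1 / 2) (exp ℂ) *
      ∑ j ∈ Finset.range (m + 1),
        C (kummerBesselCoeff m b j) * (X ^ j * besselSeries (b + j + 1 / 2)))) a := by
    simp only [coeff_mul _ (rescale (1 / 2) (exp ℂ)), map_sum, coeff_C_mul, coeff_X_pow_mul']
    refine tendsto_finsetSum _ fun p _ => tendsto_const_nhds.mul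
      (tendsto_finsetSum _ fun j hj => ?_)
    refine (continuousAt_kummerBesselCoeff (by simpa [Nat.lt_succ_iff] using hj) hc ha h0).mul ?_
    by_cases h : j ≤ p.2
    · simp only [h, if_true]
      have hj' : ∀ i : ℕ, a + j + 1 / 2 ≠ -(i : ℂ) := fun i => by
        rw [show a + j + 1 / 2 = a + 1 / 2 + (j : ℂ) by ring]
        exact ne_neg_natCast_add ha j i
      exact ContinuousAt.comp (f := fun b : ℂ => b + j + 1 / 2)
        (continuousAt_coeff_besselSeries hj' _) (by fun_prop)
    · simp only [h, if_false]
      exact continuousAt_const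
  -- Both coefficients are continuous at `a` and agree on a set whose closure contains `a`.
  refine tendsto_nhds_unique_of_eventuallyEq (l := nhdsWithin a {b : ℂ | ∀ z : ℤ, 2 * b ≠ z})
    (hL.tendsto.mono_left nhdsWithin_le_nhds)
    (hR.tendsto.mono_left nhdsWithin_le_nhds) ?_
  filter_upwards [self_mem_nhdsWithin] with b hb
  rw [kummerSeries_expansion_generic m hb]

/-- The product of two Kummer series as a combination of `₂F₃` series. -/
lemma kummerSeries_mul_kummerSeries (m n : ℕ) {α β : ℂ}
    (hα : ∀ i : ℕ, 2 * α + m ≠ -(i : ℂ)) (hβ : ∀ i : ℕ, 2 * β + n ≠ -(i : ℂ))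
    (hα' : ∀ i : ℕ, α + 1 / 2 ≠ -(i : ℂ)) (hβ' : ∀ i : ℕ, β + 1 / 2 ≠ -(i : ℂ))
    (hαβ : ∀ i : ℕ, α + β ≠ -(i : ℂ))
    (hα₀ : m ≠ 0 → α ≠ 1 / 2) (hβ₀ : n ≠ 0 → β ≠ 1 / 2) :
    kummerSeries α (2 * α + m) * kummerSeries β (2 * β + n) =
      exp ℂ * ∑ j ∈ Finset.range (m + 1), ∑ k ∈ Finset.range (n + 1),
        C (kummerBesselCoeff m α j * kummerBesselCoeff n β k) *
          (X ^ (j + k) * besselProdSeries (α + j + 1 / 2) (β + k + 1 / 2) (α + β + j + k)) := by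
  rw [kummerSeries_expansion m hα hα' hα₀, kummerSeries_expansion n hβ hβ' hβ₀,
    mul_mul_mul_comm, exp_mul_exp_eq_exp_add, Finset.sum_mul_sum]
  rw [show (1 / 2 + 1 / 2 : ℂ) = 1 by norm_num, rescale_one, RingHom.id_apply]
  congr 1
  refine Finset.sum_congr rfl fun j _ => Finset.sum_congr rfl fun k _ => ?_
  rw [← besselSeries_mul_besselSeries (s := α + β + j + k), map_mul, pow_add]
  · ring
  · intro i
    rw [show α + j + 1 / 2 = α + 1 / 2 + (j : ℂ) by ring]
    exact ne_neg_natCast_add hα' j i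
  · intro i
    rw [show β + k + 1 / 2 = β + 1 / 2 + (k : ℂ) by ring]
    exact ne_neg_natCast_add hβ' k i
  · exact ne_neg_natCast_add (ne_neg_natCast_add hαβ j) k
  · ring

lemma exp_mul_rescale_neg_one_exp : exp ℂ * rescale (-1) (exp ℂ) = 1 := by
  have := exp_mul_exp_eq_exp_add (A := ℂ) 1 (-1)
  simpa using this

/-! ### Growth of coefficients -/

/-- The sequence `u` grows more slowly than every geometric sequence of ratio `ρ > 1`. -/
def Subexponential (u : ℕ → ℂ) : Prop := ∀ ρ : ℝ, 1 < ρ → ∃ K : ℝ, ∀ k, ‖u k‖ ≤ K * ρ ^ k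

lemma subexponential_of_ratio {u : ℕ → ℂ} {r : ℕ → ℝ} (hr : Tendsto r atTop (𝓝 1))
    (hu : ∀ k, ‖u (k + 1)‖ ≤ r k * ‖u k‖) : Subexponential u := by
  intro ρ hρ
  have hρ0 : 0 < ρ := by linarith
  have hev : ∀ᶠ k in atTop, r k ≤ (1 + ρ) / 2 := hr.eventually_le_const (by linarith)
  have hs : Summable fun k => u k / (ρ : ℂ) ^ k := by
    -- The ratios of u_k are eventually at most the midpoint of 1 and ρ, so u_k / ρ^k is summable
    -- and hence bounded.
    refine summable_of_ratio_norm_eventually_le (r := (1 + ρ) / 2 / ρ) ?_ ?_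
    · rw [div_lt_one hρ0]; linarith
    · filter_upwards [hev] with k hk
      rw [norm_div, norm_div, norm_pow, norm_pow, Complex.norm_real, Real.norm_of_nonneg hρ0.le,
        pow_succ]
      calc ‖u (k + 1)‖ / (ρ ^ k * ρ) ≤ ((1 + ρ) / 2 * ‖u k‖) / (ρ ^ k * ρ) := by
            gcongr
            exact (hu k).trans (by gcongr)
        _ = (1 + ρ) / 2 / ρ * (‖u k‖ / ρ ^ k) := by field_simp
  obtain ⟨K, hK⟩ := hs.tendsto_atTop_zero.norm.bddAbove_range
  refine ⟨K, fun k => ?_⟩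
  have h := hK ⟨k, rfl⟩
  simp only [norm_div, norm_pow, Complex.norm_real, Real.norm_of_nonneg hρ0.le] at h
  rwa [div_le_iff₀ (by positivity)] at h

lemma Subexponential.mul {u v : ℕ → ℂ} (hu : Subexponential u) (hv : Subexponential v) :
    Subexponential fun k => u k * v k := by
  intro ρ hρ
  have h1 : 1 < √ρ := by rw [Real.lt_sqrt zero_le_one]; simpa using hρ
  obtain ⟨K, hK⟩ := hu _ h1
  obtain ⟨M, hM⟩ := hv _ h1
  refine ⟨K * M, fun k => ?_⟩
  rw [norm_mul]
  calc ‖u k‖ * ‖v k‖ ≤ (K * √ρ ^ k) * (M * √ρ ^ k) :=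
        mul_le_mul (hK k) (hM k) (norm_nonneg _) ((norm_nonneg _).trans (hK k))
    _ = K * M * (√ρ * √ρ) ^ k := by rw [mul_pow]; ring
    _ = K * M * ρ ^ k := by rw [Real.mul_self_sqrt (by linarith)]

/-- The successive ratio (a+k)/(c+k) tends to 1. Division by zero yields 0, so the recurrence
survives for every `c`. -/
lemma subexponential_poch_div_poch (a c : ℂ) :
    Subexponential fun k => poch a k / poch c k := by
  have h := tendsto_add_mul_div_add_mul_atTop_nhds a c 1 (one_ne_zero (α := ℂ))
  simp only [one_mul, div_one] at h
  have h' := h.norm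
  rw [norm_one] at h'
  refine subexponential_of_ratio h' fun k => le_of_eq ?_
  rw [← norm_mul, poch_succ, poch_succ, mul_comm (poch a k), mul_comm (poch c k),
    mul_div_mul_comm]

/-- Power series whose coefficients `a k` satisfy that `k ! * a k` is subexponential. -/
def ExpType (A : ℂ⟦X⟧) : Prop := Subexponential fun k => (k ! : ℂ) * coeff k A

lemma expType_kummerSeries (a c : ℂ) : ExpType (kummerSeries a c) := by
  have h := subexponential_poch_div_poch a c
  refine cast (congrArg Subexponential (funext fun k => ?_)) h
  have := factorial_ne_zero' k
  rw [coeff_kummerSeries]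
  field_simp

lemma expType_exp : ExpType (exp ℂ) := by
  intro ρ hρ
  refine ⟨1, fun k => ?_⟩
  have := factorial_ne_zero' k
  simp [coeff_exp, this]
  exact one_le_pow₀ hρ.le

lemma ExpType.rescale_neg_one {A : ℂ⟦X⟧} (hA : ExpType A) : ExpType (rescale (-1) A) := by
  intro ρ hρ
  obtain ⟨K, hK⟩ := hA ρ hρ
  refine ⟨K, fun k => ?_⟩
  simpa [coeff_rescale] using hK k

lemma expType_besselProdSeries (a b s : ℂ) : ExpType (besselProdSeries a b s) := by
  intro ρ hρ
  obtain ⟨K, hK⟩ := (((subexponential_poch_div_poch (s / 2) a).mul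
    (subexponential_poch_div_poch ((s + 1) / 2) b)).mul
    (subexponential_poch_div_poch (1 / 2) s)) ρ hρ
  have hK0 : 0 ≤ K := by simpa using (norm_nonneg _).trans (hK 0)
  refine ⟨K, fun k => ?_⟩
  rcases Nat.even_or_odd' k with ⟨q, rfl | rfl⟩
  · have h4 := factorial_ne_zero' q
    -- This factorial identity turns (2q)! times the coefficient into a product of three Pochhammer
    -- quotients.
    have e : (((2 * q)! : ℕ) : ℂ) = 4 ^ q * poch (1 / 2) q * (q ! : ℂ) := by
      rw [← poch_one (2 * q), poch_two_mul, show ((1 : ℂ) + 1) / 2 = 1 by norm_num, poch_one]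
    simp only [besselProdSeries, coeff_evenSeries_two_mul, besselProdCoeff, e]
    refine le_trans (le_of_eq ?_) ((hK q).trans ?_)
    · congr 1
      field_simp
    · gcongr
      · exact hρ.le
      · omega
  · simp only [besselProdSeries, coeff_evenSeries_two_mul_add_one, mul_zero, norm_zero]
    positivity

/-! ### Summation over finite fibres -/

section Fiberwise

variable {ι κ : Type*} {δ : ι → κ} {s : κ → Finset ι}

lemma hasSum_fiber {E : Type*} [AddCommMonoid E] [TopologicalSpace E]
    (hs : ∀ i k, i ∈ s k ↔ δ i = k) (f : ι → E) (k : κ) :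
    HasSum (fun i : {i // δ i = k} => f i) (∑ i ∈ s k, f i) := by
  have h := (s k).hasSum f
  exact (Equiv.subtypeEquivRight fun i => (hs i k).symm).hasSum_iff.2 h

lemma hasSum_sum_fiber (hs : ∀ i k, i ∈ s k ↔ δ i = k) {f : ι → ℂ} {v : ℂ} (hf : HasSum f v) :
    HasSum (fun k => ∑ i ∈ s k, f i) v :=
  ((Equiv.sigmaFiberEquiv δ).hasSum_iff.2 hf).sigma fun k => hasSum_fiber hs f k

lemma summable_of_summable_sum_fiber (hs : ∀ i k, i ∈ s k ↔ δ i = k) {f : ι → ℝ}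
    (hf : ∀ i, 0 ≤ f i) (h : Summable fun k => ∑ i ∈ s k, f i) : Summable f := by
  rw [← (Equiv.sigmaFiberEquiv δ).summable_iff, summable_sigma_of_nonneg (f := f ∘ Equiv.sigmaFiberEquiv δ) fun _ => hf _]
  refine ⟨fun k => (hasSum_fiber hs f k).summable, ?_⟩
  convert h using 2 with k
  exact (hasSum_fiber hs f k).tsum_eq

end Fiberwise

open Finset.HasAntidiagonal

/-- The triples of natural numbers with sum `N`. -/
def antidiagonalTriple (N : ℕ) : Finset (ℕ × ℕ × ℕ) :=
  (antidiagonal N).biUnion fun P =>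
    (antidiagonal P.2).map ⟨fun q => (P.1, q), Prod.mk_right_injective P.1⟩

lemma mem_antidiagonalTriple (p : ℕ × ℕ × ℕ) (N : ℕ) :
    p ∈ antidiagonalTriple N ↔ p.1 + p.2.1 + p.2.2 = N := by
  obtain ⟨a, b, c⟩ := p
  simp [antidiagonalTriple, add_assoc]

lemma sum_antidiagonalTriple {E : Type*} [AddCommMonoid E] (N : ℕ) (f : ℕ × ℕ × ℕ → E) :
    ∑ p ∈ antidiagonalTriple N, f p =
      ∑ P ∈ antidiagonal N, ∑ q ∈ antidiagonal P.2, f (P.1, q) := by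
  rw [antidiagonalTriple, Finset.sum_biUnion]
  · simp
  · rintro ⟨a, b⟩ - ⟨c, d⟩ - h
    rw [Function.onFun, Finset.disjoint_left]
    rintro ⟨p, q, r⟩ h1 h2
    simp at h1 h2
    apply h
    ext
    · exact h1.2.trans h2.2.symm
    · exact h1.1.symm.trans h2.1

lemma sum_pow_div_factorial (s t : ℝ) (N : ℕ) :
    ∑ p ∈ antidiagonal N, s ^ p.1 / (p.1 ! : ℝ) * (t ^ p.2 / (p.2 ! : ℝ)) =
      (s + t) ^ N / (N ! : ℝ) := by
  rw [(Commute.all s t).add_pow', Finset.sum_div]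
  refine Finset.sum_congr rfl fun p hp => ?_
  rw [mem_antidiagonal] at hp
  have e : (N ! : ℝ) = N.choose p.1 * p.1 ! * p.2 ! := by
    rw [← hp, ← Nat.add_choose_mul_factorial_mul_factorial, ← Nat.choose_symm_add]
    push_cast; rfl
  have h : (N.choose p.1 : ℝ) ≠ 0 := by
    have : 0 < N.choose p.1 := Nat.choose_pos (by omega)
    positivity
  rw [e, nsmul_eq_mul]
  field_simp

lemma exists_one_lt_mul_le {y t : ℝ} (hy : 0 ≤ y) (h : y < t) : ∃ ρ : ℝ, 1 < ρ ∧ ρ * y ≤ t := by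
  -- Dividing by y + 1 rather than y also covers y = 0.
  refine ⟨1 + (t - y) / (y + 1), ?_, ?_⟩
  · have : 0 < (t - y) / (y + 1) := div_pos (by linarith) (by linarith)
    linarith
  · have h1 : y / (y + 1) ≤ 1 := by rw [div_le_one (by linarith)]; linarith
    have : (1 + (t - y) / (y + 1)) * y = y + (t - y) * (y / (y + 1)) := by ring
    rw [this]
    nlinarith

lemma ExpType.exists_bound {A : ℂ⟦X⟧} (hA : ExpType A) {ρ : ℝ} (hρ : 1 < ρ) :
    ∃ K : ℝ, 0 ≤ K ∧ ∀ k, ‖coeff k A‖ ≤ K * ρ ^ k / (k ! : ℝ) := by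
  obtain ⟨K, hK⟩ := hA ρ hρ
  refine ⟨K, by simpa using (norm_nonneg _).trans (hK 0), fun k => ?_⟩
  rw [le_div_iff₀ (by positivity), mul_comm]
  simpa using hK k

/-! ### Absolute convergence -/

section Convergence

variable {W : ℕ → ℂ} {x : ℂ} {t : ℝ}

lemma summable_weight_coeff {A : ℂ⟦X⟧} (hW : Summable fun N => ‖W N‖ * t ^ N / (N ! : ℝ))
    (ht : ‖x‖ < t) (hA : ExpType A) : Summable fun N => W N * coeff N A * x ^ N := by
  obtain ⟨ρ, hρ, hρt⟩ := exists_one_lt_mul_le (norm_nonneg x) ht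
  obtain ⟨K, hK0, hK⟩ := hA.exists_bound hρ
  refine Summable.of_norm_bounded (hW.mul_left K) fun N => ?_
  rw [norm_mul, norm_mul, norm_pow]
  calc ‖W N‖ * ‖coeff N A‖ * ‖x‖ ^ N ≤ ‖W N‖ * (K * ρ ^ N / (N ! : ℝ)) * ‖x‖ ^ N := by
        gcongr; exact hK N
    _ = K * (‖W N‖ * (ρ * ‖x‖) ^ N / (N ! : ℝ)) := by rw [mul_pow]; ring
    _ ≤ _ := by gcongr

/-- The terms 1/(p! q!) with p + q = N add up to 2^N / N!, whence the factor 2 in the radius. With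
three series the sum is 3^N / N!; this is the origin of the discs of radius 1/2 and 1/3. -/
lemma summable_weight_coeff_coeff {A B : ℂ⟦X⟧}
    (hW : Summable fun N => ‖W N‖ * t ^ N / (N ! : ℝ)) (ht : 2 * ‖x‖ < t)
    (hA : ExpType A) (hB : ExpType B) :
    Summable fun p : ℕ × ℕ =>
      W (p.1 + p.2) * coeff p.1 A * coeff p.2 B * x ^ (p.1 + p.2) := by
  obtain ⟨ρ, hρ, hρt⟩ := exists_one_lt_mul_le (by positivity) ht
  have hρ0 : 0 < ρ := by linarith
  obtain ⟨K, hK0, hK⟩ := hA.exists_bound hρ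
  obtain ⟨M, hM0, hM⟩ := hB.exists_bound hρ
  have hs : ∀ (i : ℕ × ℕ) N, i ∈ antidiagonal N ↔ i.1 + i.2 = N := fun i N => mem_antidiagonal
  refine Summable.of_norm_bounded (g := fun p : ℕ × ℕ => K * M *
    (‖W (p.1 + p.2)‖ * (ρ * ‖x‖) ^ (p.1 + p.2) / ((p.1 ! : ℝ) * (p.2 ! : ℝ)))) ?_ fun p => ?_
  · refine Summable.mul_left _ (summable_of_summable_sum_fiber hs (fun p => by positivity) ?_)
    refine Summable.of_nonneg_of_le (fun N => Finset.sum_nonneg fun p _ => by positivity)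
      (fun N => ?_) hW
    have h : ∀ p ∈ antidiagonal N, ‖W (p.1 + p.2)‖ * (ρ * ‖x‖) ^ (p.1 + p.2) /
        ((p.1 ! : ℝ) * (p.2 ! : ℝ)) = ‖W N‖ * (ρ * ‖x‖) ^ N *
          ((1 : ℝ) ^ p.1 / (p.1 ! : ℝ) * ((1 : ℝ) ^ p.2 / (p.2 ! : ℝ))) := by
      intro p hp
      rw [mem_antidiagonal.1 hp]
      simp only [one_pow]
      field_simp
    rw [Finset.sum_congr rfl h, ← Finset.mul_sum, sum_pow_div_factorial]
    calc _ = ‖W N‖ * (ρ * (2 * ‖x‖)) ^ N / (N ! : ℝ) := by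
          rw [mul_pow, mul_pow, mul_pow]; norm_num; ring
      _ ≤ _ := by gcongr
  · rw [norm_mul, norm_mul, norm_mul, norm_pow]
    calc _ ≤ ‖W (p.1 + p.2)‖ * (K * ρ ^ p.1 / (p.1 ! : ℝ)) * (M * ρ ^ p.2 / (p.2 ! : ℝ)) *
          ‖x‖ ^ (p.1 + p.2) := by
          gcongr
          · exact hK _
          · exact hM _
      _ = _ := by rw [mul_pow, pow_add ρ]; field_simp

lemma summable_weight_coeff_coeff_coeff {A B D : ℂ⟦X⟧}
    (hW : Summable fun N => ‖W N‖ * t ^ N / (N ! : ℝ)) (ht : 3 * ‖x‖ < t)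
    (hA : ExpType A) (hB : ExpType B) (hD : ExpType D) :
    Summable fun p : ℕ × ℕ × ℕ => W (p.1 + p.2.1 + p.2.2) * coeff p.1 A * coeff p.2.1 B *
      coeff p.2.2 D * x ^ (p.1 + p.2.1 + p.2.2) := by
  obtain ⟨ρ, hρ, hρt⟩ := exists_one_lt_mul_le (by positivity) ht
  have hρ0 : 0 < ρ := by linarith
  obtain ⟨K, hK0, hK⟩ := hA.exists_bound hρ
  obtain ⟨M, hM0, hM⟩ := hB.exists_bound hρ
  obtain ⟨L, hL0, hL⟩ := hD.exists_bound hρ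
  refine Summable.of_norm_bounded (g := fun p : ℕ × ℕ × ℕ => K * M * L *
    (‖W (p.1 + p.2.1 + p.2.2)‖ * (ρ * ‖x‖) ^ (p.1 + p.2.1 + p.2.2) /
      ((p.1 ! : ℝ) * (p.2.1 ! : ℝ) * (p.2.2 ! : ℝ)))) ?_ fun p => ?_
  · refine Summable.mul_left _
      (summable_of_summable_sum_fiber mem_antidiagonalTriple (fun p => by positivity) ?_)
    refine Summable.of_nonneg_of_le (fun N => Finset.sum_nonneg fun p _ => by positivity)
      (fun N => ?_) hW
    have h : ∀ P ∈ antidiagonal N, ∑ q ∈ antidiagonal P.2,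
        ‖W (P.1 + q.1 + q.2)‖ * (ρ * ‖x‖) ^ (P.1 + q.1 + q.2) /
        ((P.1 ! : ℝ) * (q.1 ! : ℝ) * (q.2 ! : ℝ)) = ‖W N‖ * (ρ * ‖x‖) ^ N *
          ((1 : ℝ) ^ P.1 / (P.1 ! : ℝ) * ((1 + 1 : ℝ) ^ P.2 / (P.2 ! : ℝ))) := by
      intro P hP
      rw [← sum_pow_div_factorial, Finset.mul_sum, Finset.mul_sum]
      refine Finset.sum_congr rfl fun q hq => ?_
      rw [add_assoc, mem_antidiagonal.1 hq, mem_antidiagonal.1 hP]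
      simp only [one_pow]
      field_simp
    rw [sum_antidiagonalTriple, Finset.sum_congr rfl h, ← Finset.mul_sum, sum_pow_div_factorial]
    calc _ = ‖W N‖ * (ρ * (3 * ‖x‖)) ^ N / (N ! : ℝ) := by
          rw [mul_pow, mul_pow, mul_pow]; norm_num; ring
      _ ≤ _ := by gcongr
  · rw [norm_mul, norm_mul, norm_mul, norm_mul, norm_pow]
    calc _ ≤ ‖W (p.1 + p.2.1 + p.2.2)‖ * (K * ρ ^ p.1 / (p.1 ! : ℝ)) *
          (M * ρ ^ p.2.1 / (p.2.1 ! : ℝ)) * (L * ρ ^ p.2.2 / (p.2.2 ! : ℝ)) *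
          ‖x‖ ^ (p.1 + p.2.1 + p.2.2) := by
          gcongr
          · exact hK _
          · exact hM _
          · exact hL _
      _ = _ := by rw [mul_pow, pow_add ρ, pow_add ρ]; field_simp

lemma summable_poch_div_poch_mul_pow (d e : ℂ) {t : ℝ} (ht : 0 ≤ t) :
    Summable fun N => ‖poch d N / poch e N‖ * t ^ N / (N ! : ℝ) := by
  obtain ⟨K, hK⟩ := subexponential_poch_div_poch d e 2 one_lt_two
  refine Summable.of_nonneg_of_le (fun N => by positivity) (fun N => ?_)
    ((Real.summable_pow_div_factorial (2 * t)).mul_left K)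
  calc _ ≤ K * 2 ^ N * t ^ N / (N ! : ℝ) := by gcongr; exact hK N
    _ = _ := by rw [mul_pow]; ring

/-- The quotient (d)_N / N! is subexponential, so a geometric series dominates. -/
lemma summable_poch_mul_pow (d : ℂ) {t : ℝ} (ht : 0 ≤ t) (ht1 : t < 1) :
    Summable fun N => ‖poch d N‖ * t ^ N / (N ! : ℝ) := by
  obtain ⟨ρ, hρ, hρ'⟩ := exists_one_lt_mul_le ht (show t < (1 + t) / 2 by linarith)
  have hρ0 : 0 < ρ := by linarith
  obtain ⟨K, hK⟩ := subexponential_poch_div_poch d 1 ρ hρ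
  refine Summable.of_nonneg_of_le (fun N => by positivity) (fun N => ?_)
    ((summable_geometric_of_lt_one (r := ρ * t) (by positivity) (by linarith)).mul_left K)
  have h := hK N
  simp only [poch_one, norm_div, Complex.norm_natCast] at h
  calc _ = ‖poch d N‖ / (N ! : ℝ) * t ^ N := by ring
    _ ≤ K * ρ ^ N * t ^ N := by gcongr
    _ = _ := by rw [mul_pow]; ring

end Convergence

/-! ### Collecting terms of equal degree -/

section Regrouping

variable {W : ℕ → ℂ} {x v : ℂ}

lemma hasSum_coeff_mul {A B : ℂ⟦X⟧} {f : ℕ × ℕ → ℂ}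
    (hf : ∀ p, f p = W (p.1 + p.2) * coeff p.1 A * coeff p.2 B * x ^ (p.1 + p.2))
    (h : HasSum f v) : HasSum (fun N => W N * coeff N (A * B) * x ^ N) v := by
  have hs : ∀ (i : ℕ × ℕ) N, i ∈ antidiagonal N ↔ i.1 + i.2 = N := fun i N => mem_antidiagonal
  convert hasSum_sum_fiber hs h using 2 with N
  rw [coeff_mul, Finset.mul_sum, Finset.sum_mul]
  refine Finset.sum_congr rfl fun p hp => ?_
  rw [hf, mem_antidiagonal.1 hp]
  ring

lemma hasSum_coeff_mul_mul {A B D : ℂ⟦X⟧} {f : ℕ × ℕ × ℕ → ℂ}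
    (hf : ∀ p, f p = W (p.1 + p.2.1 + p.2.2) * coeff p.1 A * coeff p.2.1 B *
      coeff p.2.2 D * x ^ (p.1 + p.2.1 + p.2.2))
    (h : HasSum f v) : HasSum (fun N => W N * coeff N (A * (B * D)) * x ^ N) v := by
  convert hasSum_sum_fiber mem_antidiagonalTriple h using 2 with N
  rw [sum_antidiagonalTriple, coeff_mul, Finset.mul_sum, Finset.sum_mul]
  refine Finset.sum_congr rfl fun P hP => ?_
  rw [coeff_mul, Finset.mul_sum, Finset.mul_sum, Finset.sum_mul]
  refine Finset.sum_congr rfl fun q hq => ?_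
  rw [hf, add_assoc, mem_antidiagonal.1 hq, mem_antidiagonal.1 hP]
  ring

lemma hasSum_coeff_evenSeries {c f : ℕ → ℂ} (hf : ∀ q, f q = W (2 * q) * c q * x ^ (2 * q))
    (h : HasSum f v) : HasSum (fun N => W N * coeff N (evenSeries c) * x ^ N) v := by
  have hi : Function.Injective fun q : ℕ => 2 * q := fun a b h => by simpa using h
  refine (hi.hasSum_iff fun l hl => ?_).1 (h.congr_fun fun q => ?_)
  · rw [coeff_evenSeries_of_not_even]
    · ring
    · rintro ⟨q, rfl⟩
      exact hl ⟨q, two_mul q⟩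
  · simp only [Function.comp, coeff_evenSeries_two_mul, hf]

lemma hasSum_coeff_mul_evenSeries {A : ℂ⟦X⟧} {c : ℕ → ℂ} {f : ℕ × ℕ → ℂ}
    (hf : ∀ p, f p = W (p.1 + 2 * p.2) * coeff p.1 A * c p.2 * x ^ (p.1 + 2 * p.2))
    (h : HasSum f v) : HasSum (fun N => W N * coeff N (A * evenSeries c) * x ^ N) v := by
  have hi : Function.Injective fun p : ℕ × ℕ => (p.1, 2 * p.2) := by
    rintro ⟨a, b⟩ ⟨c, d⟩ h
    simpa using h
  refine hasSum_coeff_mul (fun p => rfl) ((hi.hasSum_iff fun p hp => ?_).1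
    (h.congr_fun fun p => ?_))
  · rw [coeff_evenSeries_of_not_even]
    · ring
    · rintro ⟨q, hq⟩
      exact hp ⟨(p.1, q), by ext <;> simp [hq, two_mul]⟩
  · simp only [Function.comp, coeff_evenSeries_two_mul, hf]

/-- The factorization of the weight is what turns `d`, `e` into d + j + k, e + j + k. -/
lemma hasSum_coeff_X_pow_mul {V : ℕ → ℂ} {A : ℂ⟦X⟧} {s : ℕ} (hV : ∀ N, W (s + N) = W s * V N)
    (h : HasSum (fun N => V N * coeff N A * x ^ N) v) :
    HasSum (fun N => W N * coeff N (X ^ s * A) * x ^ N) (W s * x ^ s * v) := by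
  have hi : Function.Injective fun N : ℕ => s + N := add_right_injective s
  refine (hi.hasSum_iff fun l hl => ?_).1 ((h.mul_left (W s * x ^ s)).congr_fun fun N => ?_)
  · rw [coeff_X_pow_mul', if_neg]
    · ring
    · intro hsl
      exact hl ⟨l - s, by simp [hsl]⟩
  · simp only [Function.comp, coeff_X_pow_mul', hV, Nat.le_add_right, if_true,
      Nat.add_sub_cancel_left, pow_add]
    ring

lemma hasSum_coeff_sum {m n : ℕ} {c : ℕ → ℕ → ℂ} {B : ℕ → ℕ → ℂ⟦X⟧} {v : ℕ → ℕ → ℂ}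
    (h : ∀ j ≤ m, ∀ k ≤ n, HasSum (fun N => W N * coeff N (B j k) * x ^ N) (v j k)) :
    HasSum (fun N => W N * coeff N (∑ j ∈ Finset.range (m + 1), ∑ k ∈ Finset.range (n + 1),
        C (c j k) * B j k) * x ^ N)
      (∑ j ∈ Finset.range (m + 1), ∑ k ∈ Finset.range (n + 1), c j k * v j k) := by
  have := hasSum_sum fun j (hj : j ∈ Finset.range (m + 1)) =>
    hasSum_sum fun k (hk : k ∈ Finset.range (n + 1)) =>
      (h j (by simpa [Nat.lt_succ_iff] using hj) k
        (by simpa [Nat.lt_succ_iff] using hk)).mul_left (c j k)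
  refine this.congr_fun fun N => ?_
  simp only [map_sum, coeff_C_mul, Finset.mul_sum, Finset.sum_mul]
  exact Finset.sum_congr rfl fun j _ => Finset.sum_congr rfl fun k _ => by ring

end Regrouping

/-! ### Series terms as weighted coefficients -/

lemma two_pow_two_mul_add (j k : ℕ) : (2 : ℂ) ^ (2 * j + 2 * k) = 4 ^ j * 4 ^ k := by
  rw [pow_add, pow_mul, pow_mul]; norm_num

lemma kampeDeFerietTerm_eq (E : List ℂ) (d a b c c' x : ℂ) (p : ℕ × ℕ) :
    kampeDeFerietTerm [d] [a] [b] E [c] [c'] x x p =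
      poch d (p.1 + p.2) / pochList E (p.1 + p.2) * coeff p.1 (kummerSeries a c) *
        coeff p.2 (kummerSeries b c') * x ^ (p.1 + p.2) := by
  simp only [kampeDeFerietTerm, coeff_kummerSeries, pow_add]
  simp only [pochList, List.map_cons, List.map_nil, List.prod_cons, List.prod_nil, mul_one]
  ring

lemma kampeDeFerietTerm_neg_eq (E : List ℂ) (d a b c c' x : ℂ) (p : ℕ × ℕ) :
    kampeDeFerietTerm [d] [a] [b] E [c] [c'] x (-x) p =
      poch d (p.1 + p.2) / pochList E (p.1 + p.2) * coeff p.1 (kummerSeries a c) *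
        coeff p.2 (rescale (-1) (kummerSeries b c')) * x ^ (p.1 + p.2) := by
  simp only [kampeDeFerietTerm, coeff_kummerSeries, pow_add, coeff_rescale, neg_pow x]
  simp only [pochList, List.map_cons, List.map_nil, List.prod_cons, List.prod_nil, mul_one]
  ring

lemma srivastavaF3Term_eq (E : List ℂ) (d a b c c' x : ℂ) (p : ℕ × ℕ × ℕ) :
    srivastavaF3Term ⟨[d], [], [], [], [], [a], [b]⟩ ⟨E, [], [], [], [], [c], [c']⟩ (-x) x x p =
      poch d (p.1 + p.2.1 + p.2.2) / pochList E (p.1 + p.2.1 + p.2.2) *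
        coeff p.1 (rescale (-1) (exp ℂ)) * coeff p.2.1 (kummerSeries a c) *
        coeff p.2.2 (kummerSeries b c') * x ^ (p.1 + p.2.1 + p.2.2) := by
  simp only [srivastavaF3Term, TripleRow.poch, coeff_kummerSeries, pow_add, coeff_rescale,
    neg_pow x, coeff_exp]
  simp only [pochList, List.map_cons, List.map_nil, List.prod_cons, List.prod_nil, mul_one,
    one_div, map_inv₀, map_natCast]
  ring

lemma srivastavaDaoustTerm_eq (E : List (ℂ × ℕ × ℕ)) (d a b s x : ℂ) (p : ℕ × ℕ) :
    srivastavaDaoustTerm [(d, 1, 2)] [] [s / 2, (s + 1) / 2] E [] [a, b, s] x (x ^ 2 / 4) p =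
      poch d (p.1 + 2 * p.2) / pochList₂ E p.1 p.2 * coeff p.1 (exp ℂ) *
        besselProdCoeff a b s p.2 * x ^ (p.1 + 2 * p.2) := by
  simp only [srivastavaDaoustTerm, besselProdCoeff, pow_add, coeff_exp, div_pow, ← pow_mul]
  simp only [pochList, pochList₂, List.map_cons, List.map_nil, List.prod_cons, List.prod_nil,
    mul_one, one_div, map_inv₀, map_natCast, mul_comm p.2 2]
  ring

lemma pFqTerm_four_five_eq (d e a b s x : ℂ) (q : ℕ) :
    pFqTerm [s / 2, (s + 1) / 2, d / 2, (d + 1) / 2] [a, b, s, e / 2, (e + 1) / 2]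
        (x ^ 2 / 4) q =
      poch d (2 * q) / poch e (2 * q) * besselProdCoeff a b s q * x ^ (2 * q) := by
  simp only [pFqTerm, besselProdCoeff, poch_two_mul, div_pow, ← pow_mul]
  simp only [pochList, List.map_cons, List.map_nil, List.prod_cons, List.prod_nil, mul_one]
  field_simp

/-- Here the 4^q from (d)_{2q} absorbs the 4^q in `besselProdCoeff`, so the argument is x². With `e`
present it cancels against that of (e)_{2q}, leaving x²/4. -/
lemma pFqTerm_four_three_eq (d a b s x : ℂ) (q : ℕ) :
    pFqTerm [s / 2, (s + 1) / 2, d / 2, (d + 1) / 2] [a, b, s] (x ^ 2) q =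
      poch d (2 * q) * besselProdCoeff a b s q * x ^ (2 * q) := by
  simp only [pFqTerm, besselProdCoeff, poch_two_mul, ← pow_mul]
  simp only [pochList, List.map_cons, List.map_nil, List.prod_cons, List.prod_nil, mul_one]
  field_simp

section Summability

variable {W : ℕ → ℂ} {x : ℂ} {t : ℝ}

lemma summable_weight_exp_besselProd (hW : Summable fun N => ‖W N‖ * t ^ N / (N ! : ℝ))
    (ht : 2 * ‖x‖ < t) (a b s : ℂ) :
    Summable fun p : ℕ × ℕ => W (p.1 + 2 * p.2) * coeff p.1 (exp ℂ) *
      besselProdCoeff a b s p.2 * x ^ (p.1 + 2 * p.2) := by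
  have hi : Function.Injective fun p : ℕ × ℕ => (p.1, 2 * p.2) := by
    rintro ⟨a, b⟩ ⟨c, d⟩ h
    simpa using h
  refine ((summable_weight_coeff_coeff hW ht expType_exp
    (expType_besselProdSeries a b s)).comp_injective hi).congr fun p => ?_
  simp only [Function.comp, besselProdSeries, coeff_evenSeries_two_mul]

lemma summable_weight_besselProd (hW : Summable fun N => ‖W N‖ * t ^ N / (N ! : ℝ))
    (ht : ‖x‖ < t) (a b s : ℂ) :
    Summable fun q : ℕ => W (2 * q) * besselProdCoeff a b s q * x ^ (2 * q) := by
  have hi : Function.Injective fun q : ℕ => 2 * q := fun a b h => by simpa using h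
  refine ((summable_weight_coeff hW ht
    (expType_besselProdSeries a b s)).comp_injective hi).congr fun p => ?_
  simp only [Function.comp, besselProdSeries, coeff_evenSeries_two_mul]

end Summability

/-! ### From formal identities to sums -/

/-- Comparison of the coefficients of two expansions, given the absolute convergence of the
series on both sides. -/
lemma hasSum_weight_sum {m n : ℕ} {W : ℕ → ℂ} {V : ℕ → ℕ → ℂ} (hV : ∀ s N, W (s + N) = W s * V s N)
    {x u : ℂ} {L : ℂ⟦X⟧} {c : ℕ → ℕ → ℂ} {B : ℕ → ℕ → ℂ⟦X⟧} {v : ℕ → ℕ → ℂ}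
    (hL : L = ∑ j ∈ Finset.range (m + 1), ∑ k ∈ Finset.range (n + 1),
      C (c j k) * (X ^ (j + k) * B j k))
    (hu : HasSum (fun N => W N * coeff N L * x ^ N) u)
    (hv : ∀ j ≤ m, ∀ k ≤ n, HasSum (fun N => V (j + k) N * coeff N (B j k) * x ^ N) (v j k)) :
    u = ∑ j ∈ Finset.range (m + 1), ∑ k ∈ Finset.range (n + 1),
      c j k * (W (j + k) * x ^ (j + k) * v j k) := by
  have h := hasSum_coeff_sum (c := c) fun j hj k hk =>
    hasSum_coeff_X_pow_mul (hV (j + k)) (hv j hj k hk)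
  rw [← hL] at h
  exact hu.unique h

section Products

variable {m n : ℕ} {α β : ℂ}

lemma rescale_neg_one_exp_mul_kummerSeries_mul (hβ : ∀ i : ℕ, 2 * β + n ≠ -(i : ℂ)) :
    rescale (-1) (exp ℂ) * (kummerSeries α (2 * α + m) * kummerSeries β (2 * β + n)) =
      kummerSeries α (2 * α + m) * rescale (-1) (kummerSeries (β + n) (2 * β + n)) := by
  rw [kummerSeries_eq_exp_mul_rescale (a := β) hβ, show 2 * β + n - β = β + n by ring]
  linear_combination kummerSeries α (2 * α + m) *
    rescale (-1) (kummerSeries (β + n) (2 * β + n)) * exp_mul_rescale_neg_one_exp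

lemma kummerSeries_mul_kummerSeries_eq_sum
    (hα : ∀ i : ℕ, 2 * α + m ≠ -(i : ℂ)) (hβ : ∀ i : ℕ, 2 * β + n ≠ -(i : ℂ))
    (hα' : ∀ i : ℕ, α + 1 / 2 ≠ -(i : ℂ)) (hβ' : ∀ i : ℕ, β + 1 / 2 ≠ -(i : ℂ))
    (hαβ : ∀ i : ℕ, α + β ≠ -(i : ℂ)) (hα₀ : m ≠ 0 → α ≠ 1 / 2) (hβ₀ : n ≠ 0 → β ≠ 1 / 2) :
    kummerSeries α (2 * α + m) * kummerSeries β (2 * β + n) =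
      ∑ j ∈ Finset.range (m + 1), ∑ k ∈ Finset.range (n + 1),
        C (kummerBesselCoeff m α j * kummerBesselCoeff n β k) * (X ^ (j + k) *
          (exp ℂ * besselProdSeries (α + j + 1 / 2) (β + k + 1 / 2) (α + β + j + k))) := by
  rw [kummerSeries_mul_kummerSeries m n hα hβ hα' hβ' hαβ hα₀ hβ₀, Finset.mul_sum]
  refine Finset.sum_congr rfl fun j _ => ?_
  rw [Finset.mul_sum]
  exact Finset.sum_congr rfl fun k _ => by ring

lemma kummerSeries_mul_rescale_kummerSeries_eq_sum
    (hα : ∀ i : ℕ, 2 * α + m ≠ -(i : ℂ)) (hβ : ∀ i : ℕ, 2 * β + n ≠ -(i : ℂ))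
    (hα' : ∀ i : ℕ, α + 1 / 2 ≠ -(i : ℂ)) (hβ' : ∀ i : ℕ, β + 1 / 2 ≠ -(i : ℂ))
    (hαβ : ∀ i : ℕ, α + β ≠ -(i : ℂ)) (hα₀ : m ≠ 0 → α ≠ 1 / 2) (hβ₀ : n ≠ 0 → β ≠ 1 / 2) :
    kummerSeries α (2 * α + m) * rescale (-1) (kummerSeries (β + n) (2 * β + n)) =
      ∑ j ∈ Finset.range (m + 1), ∑ k ∈ Finset.range (n + 1),
        C (kummerBesselCoeff m α j * kummerBesselCoeff n β k) * (X ^ (j + k) *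
          besselProdSeries (α + j + 1 / 2) (β + k + 1 / 2) (α + β + j + k)) := by
  rw [← rescale_neg_one_exp_mul_kummerSeries_mul hβ,
    kummerSeries_mul_kummerSeries m n hα hβ hα' hβ' hαβ hα₀ hβ₀, ← mul_assoc,
    mul_comm (rescale _ _), exp_mul_rescale_neg_one_exp, one_mul]

end Products

lemma poch_div_poch_add (d e : ℂ) (s N : ℕ) :
    poch d (s + N) / poch e (s + N) =
      poch d s / poch e s * (poch (d + s) N / poch (e + s) N) := by
  rw [poch_add, poch_add, mul_div_mul_comm]

/-- Collected by degree, both series have the same terms, because the underlying products agree by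
Kummer's first transformation. -/
lemma kampeDeFeriet_eq_srivastavaF3 {n : ℕ} (m : ℕ) {β : ℂ} (hβ : ∀ i : ℕ, 2 * β + n ≠ -(i : ℂ))
    (E : List ℂ) (d α x : ℂ)
    (h₂ : Summable (kampeDeFerietTerm [d] [α] [β + n] E [2 * α + m] [2 * β + n] x (-x)))
    (h₃ : Summable (srivastavaF3Term ⟨[d], [], [], [], [], [α], [β]⟩
      ⟨E, [], [], [], [], [2 * α + m], [2 * β + n]⟩ (-x) x x)) :
    kampeDeFeriet [d] [α] [β + n] E [2 * α + m] [2 * β + n] x (-x) =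
      srivastavaF3 ⟨[d], [], [], [], [], [α], [β]⟩
        ⟨E, [], [], [], [], [2 * α + m], [2 * β + n]⟩ (-x) x x := by
  have h := hasSum_coeff_mul (W := fun N => poch d N / pochList E N)
    (kampeDeFerietTerm_neg_eq E d α (β + n) (2 * α + m) (2 * β + n) x) h₂.hasSum
  have h' := hasSum_coeff_mul_mul (W := fun N => poch d N / pochList E N)
    (srivastavaF3Term_eq E d α β (2 * α + m) (2 * β + n) x) h₃.hasSum
  rw [rescale_neg_one_exp_mul_kummerSeries_mul hβ] at h'
  exact h.unique h'

end

theorem theorem1 (m n : ℕ) (d e α β : ℂ) (hd : 0 < d.re) (hde : d.re < e.re)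
    -- no zero denominators: `2α + m`, `2β + n`, `α + 1/2`, `β + 1/2`, `α + β` are not in
    -- `{0, -1, -2, …}`, and `α = 1/2` (`β = 1/2`) is allowed only for `m = 0` (`n = 0`)
    (hα : ∀ i : ℕ, 2 * α + m ≠ -(i : ℂ)) (hβ : ∀ i : ℕ, 2 * β + n ≠ -(i : ℂ))
    (hα' : ∀ i : ℕ, α + 1 / 2 ≠ -(i : ℂ)) (hβ' : ∀ i : ℕ, β + 1 / 2 ≠ -(i : ℂ))
    (hαβ : ∀ i : ℕ, α + β ≠ -(i : ℂ))
    (hα₀ : m ≠ 0 → α ≠ 1 / 2) (hβ₀ : n ≠ 0 → β ≠ 1 / 2) :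
    -- first formula: all `x`
    (∀ x : ℂ,
      Summable (kampeDeFerietTerm [d] [α] [β] [e] [2 * α + m] [2 * β + n] x x) ∧
      (∀ j ≤ m, ∀ k ≤ n, Summable (srivastavaDaoustTerm
        [(d + j + k, 1, 2)] [] [(α + β + j + k) / 2, (α + β + j + k + 1) / 2]
        [(e + j + k, 1, 2)] [] [α + j + 1 / 2, β + k + 1 / 2, α + β + j + k]
        x (x ^ 2 / 4))) ∧
      kampeDeFeriet [d] [α] [β] [e] [2 * α + m] [2 * β + n] x x =
        ∑ j ∈ Finset.range (m + 1), ∑ k ∈ Finset.range (n + 1),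
          (poch d (j + k) * poch (-m) j * poch (-n) k * poch (2 * α - 1) j *
              poch (2 * β - 1) k * x ^ (j + k)) /
            (poch e (j + k) * poch (2 * α + m) j * poch (2 * β + n) k *
              poch (α - 1 / 2) j * poch (β - 1 / 2) k * 2 ^ (2 * j + 2 * k) *
              (j ! : ℂ) * (k ! : ℂ)) *
          srivastavaDaoust
            [(d + j + k, 1, 2)] [] [(α + β + j + k) / 2, (α + β + j + k + 1) / 2]
            [(e + j + k, 1, 2)] [] [α + j + 1 / 2, β + k + 1 / 2, α + β + j + k]
            x (x ^ 2 / 4)) ∧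
    -- second formula: all `x`
    (∀ x : ℂ,
      Summable (kampeDeFerietTerm [d] [α] [β + n] [e] [2 * α + m] [2 * β + n] x (-x)) ∧
      Summable (srivastavaF3Term ⟨[d], [], [], [], [], [α], [β]⟩
        ⟨[e], [], [], [], [], [2 * α + m], [2 * β + n]⟩ (-x) x x) ∧
      (∀ j ≤ m, ∀ k ≤ n, Summable (pFqTerm
        [(α + β + j + k) / 2, (α + β + j + k + 1) / 2, (d + j + k) / 2, (d + j + k + 1) / 2]
        [α + j + 1 / 2, β + k + 1 / 2, α + β + j + k, (e + j + k) / 2, (e + j + k + 1) / 2]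
        (x ^ 2 / 4))) ∧
      kampeDeFeriet [d] [α] [β + n] [e] [2 * α + m] [2 * β + n] x (-x) =
        srivastavaF3 ⟨[d], [], [], [], [], [α], [β]⟩
          ⟨[e], [], [], [], [], [2 * α + m], [2 * β + n]⟩ (-x) x x ∧
      kampeDeFeriet [d] [α] [β + n] [e] [2 * α + m] [2 * β + n] x (-x) =
        ∑ j ∈ Finset.range (m + 1), ∑ k ∈ Finset.range (n + 1),
          (poch d (j + k) * poch (-m) j * poch (-n) k * poch (2 * α - 1) j *
              poch (2 * β - 1) k * x ^ (j + k)) /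
            (poch e (j + k) * poch (2 * α + m) j * poch (2 * β + n) k *
              poch (α - 1 / 2) j * poch (β - 1 / 2) k * 2 ^ (2 * j + 2 * k) *
              (j ! : ℂ) * (k ! : ℂ)) *
          pFq
            [(α + β + j + k) / 2, (α + β + j + k + 1) / 2,
              (d + j + k) / 2, (d + j + k + 1) / 2]
            [α + j + 1 / 2, β + k + 1 / 2, α + β + j + k,
              (e + j + k) / 2, (e + j + k + 1) / 2]
            (x ^ 2 / 4)) ∧
    -- third formula: all series converge absolutely for `|x| < 1/2`, and the formula holds
    -- wherever they do
    (∀ x : ℂ,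
      (‖x‖ < 1 / 2 →
        Summable (kampeDeFerietTerm [d] [α] [β] [] [2 * α + m] [2 * β + n] x x) ∧
        ∀ j ≤ m, ∀ k ≤ n, Summable (srivastavaDaoustTerm
          [(d + j + k, 1, 2)] [] [(α + β + j + k) / 2, (α + β + j + k + 1) / 2]
          [] [] [α + j + 1 / 2, β + k + 1 / 2, α + β + j + k]
          x (x ^ 2 / 4))) ∧
      (Summable (kampeDeFerietTerm [d] [α] [β] [] [2 * α + m] [2 * β + n] x x) →
        (∀ j ≤ m, ∀ k ≤ n, Summable (srivastavaDaoustTerm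
          [(d + j + k, 1, 2)] [] [(α + β + j + k) / 2, (α + β + j + k + 1) / 2]
          [] [] [α + j + 1 / 2, β + k + 1 / 2, α + β + j + k]
          x (x ^ 2 / 4))) →
        kampeDeFeriet [d] [α] [β] [] [2 * α + m] [2 * β + n] x x =
          ∑ j ∈ Finset.range (m + 1), ∑ k ∈ Finset.range (n + 1),
            (poch d (j + k) * poch (-m) j * poch (-n) k * poch (2 * α - 1) j *
                poch (2 * β - 1) k * x ^ (j + k)) /
              (poch (2 * α + m) j * poch (2 * β + n) k *
                poch (α - 1 / 2) j * poch (β - 1 / 2) k * 2 ^ (2 * j + 2 * k) *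
                (j ! : ℂ) * (k ! : ℂ)) *
            srivastavaDaoust
              [(d + j + k, 1, 2)] [] [(α + β + j + k) / 2, (α + β + j + k + 1) / 2]
              [] [] [α + j + 1 / 2, β + k + 1 / 2, α + β + j + k]
              x (x ^ 2 / 4))) ∧
    -- fourth formula: the double series and the `4F3` converge absolutely for `|x| < 1/2`, the
    -- triple series for `|x| < 1/3`, and each equality holds wherever its series do
    (∀ x : ℂ,
      (‖x‖ < 1 / 2 →
        Summable (kampeDeFerietTerm [d] [α] [β + n] [] [2 * α + m] [2 * β + n] x (-x)) ∧
        ∀ j ≤ m, ∀ k ≤ n, Summable (pFqTerm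
          [(α + β + j + k) / 2, (α + β + j + k + 1) / 2,
            (d + j + k) / 2, (d + j + k + 1) / 2]
          [α + j + 1 / 2, β + k + 1 / 2, α + β + j + k] (x ^ 2))) ∧
      (‖x‖ < 1 / 3 →
        Summable (srivastavaF3Term ⟨[d], [], [], [], [], [α], [β]⟩
          ⟨[], [], [], [], [], [2 * α + m], [2 * β + n]⟩ (-x) x x)) ∧
      (Summable (kampeDeFerietTerm [d] [α] [β + n] [] [2 * α + m] [2 * β + n] x (-x)) →
        Summable (srivastavaF3Term ⟨[d], [], [], [], [], [α], [β]⟩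
          ⟨[], [], [], [], [], [2 * α + m], [2 * β + n]⟩ (-x) x x) →
        kampeDeFeriet [d] [α] [β + n] [] [2 * α + m] [2 * β + n] x (-x) =
          srivastavaF3 ⟨[d], [], [], [], [], [α], [β]⟩
            ⟨[], [], [], [], [], [2 * α + m], [2 * β + n]⟩ (-x) x x) ∧
      (Summable (kampeDeFerietTerm [d] [α] [β + n] [] [2 * α + m] [2 * β + n] x (-x)) →
        (∀ j ≤ m, ∀ k ≤ n, Summable (pFqTerm
          [(α + β + j + k) / 2, (α + β + j + k + 1) / 2,
            (d + j + k) / 2, (d + j + k + 1) / 2]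
          [α + j + 1 / 2, β + k + 1 / 2, α + β + j + k] (x ^ 2))) →
        kampeDeFeriet [d] [α] [β + n] [] [2 * α + m] [2 * β + n] x (-x) =
          ∑ j ∈ Finset.range (m + 1), ∑ k ∈ Finset.range (n + 1),
            (poch d (j + k) * poch (-m) j * poch (-n) k * poch (2 * α - 1) j *
                poch (2 * β - 1) k * x ^ (j + k)) /
              (poch (2 * α + m) j * poch (2 * β + n) k *
                poch (α - 1 / 2) j * poch (β - 1 / 2) k * 2 ^ (2 * j + 2 * k) *
                (j ! : ℂ) * (k ! : ℂ)) *
            pFq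
              [(α + β + j + k) / 2, (α + β + j + k + 1) / 2,
                (d + j + k) / 2, (d + j + k + 1) / 2]
              [α + j + 1 / 2, β + k + 1 / 2, α + β + j + k]
              (x ^ 2))) := by
  have hV : ∀ (e : ℂ) (s N : ℕ), (fun N => poch d N / poch e N) (s + N) =
      (fun N => poch d N / poch e N) s * (fun (s : ℕ) N => poch (d + s) N / poch (e + s) N) s N :=
    fun e s N => poch_div_poch_add d e s N
  have hV₀ : ∀ (s N : ℕ), (fun N => poch d N) (s + N) =
      (fun N => poch d N) s * (fun (s : ℕ) N => poch (d + s) N) s N :=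
    fun s N => poch_add d s N
  have hcast : ∀ (a : ℂ) (j k : ℕ), a + ((j + k : ℕ) : ℂ) = a + j + k := fun a j k => by
    push_cast; ring
  have hE : ∀ N, pochList [e] N = poch e N := fun N => by simp [pochList]
  have hE₀ : ∀ N, pochList [] N = 1 := fun N => by simp [pochList]
  have hE' : ∀ (e : ℂ) p q, pochList₂ [(e, 1, 2)] p q = poch e (p + 2 * q) := fun e p q => by
    simp [pochList₂, mul_comm]
  have hE₀' : ∀ p q, pochList₂ [] p q = 1 := fun p q => by simp [pochList₂]
  have k1 := expType_kummerSeries α (2 * α + m)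
  have k2 := expType_kummerSeries β (2 * β + n)
  have k3 := (expType_kummerSeries (β + n) (2 * β + n)).rescale_neg_one
  refine ⟨fun x => ?_, fun x => ?_, fun x => ?_, fun x => ?_⟩
  -- The weights (d)_N / (e)_N allow every radius; 2‖x‖ + 1 is just one exceeding 2‖x‖.
  · have hW : ∀ d e : ℂ, Summable fun N => ‖poch d N / poch e N‖ * (2 * ‖x‖ + 1) ^ N / (N ! : ℝ) :=
      fun d e => summable_poch_div_poch_mul_pow d e (by positivity)
    have s1 : Summable (kampeDeFerietTerm [d] [α] [β] [e] [2 * α + m] [2 * β + n] x x) := by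
      refine (summable_weight_coeff_coeff (hW d e) (lt_add_one _) k1 k2).congr fun p => ?_
      rw [kampeDeFerietTerm_eq, hE]
    have s2 : ∀ j ≤ m, ∀ k ≤ n, Summable (srivastavaDaoustTerm
        [(d + j + k, 1, 2)] [] [(α + β + j + k) / 2, (α + β + j + k + 1) / 2]
        [(e + j + k, 1, 2)] [] [α + j + 1 / 2, β + k + 1 / 2, α + β + j + k]
        x (x ^ 2 / 4)) := by
      intro j _ k _
      refine (summable_weight_exp_besselProd (hW (d + j + k) (e + j + k)) (lt_add_one _)
        (α + j + 1 / 2) (β + k + 1 / 2)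
        (α + β + j + k)).congr fun p => ?_
      rw [srivastavaDaoustTerm_eq, hE']
    refine ⟨s1, s2, ?_⟩
    have h := hasSum_weight_sum (hV e)
      (kummerSeries_mul_kummerSeries_eq_sum hα hβ hα' hβ' hαβ hα₀ hβ₀)
      (hasSum_coeff_mul (W := fun N => poch d N / poch e N)
        (fun p => by rw [kampeDeFerietTerm_eq, hE]) s1.hasSum)
      (fun j hj k hk => hasSum_coeff_mul_evenSeries
        (fun p => by rw [srivastavaDaoustTerm_eq, hE']; simp only [hcast]) (s2 j hj k hk).hasSum)
    refine h.trans (Finset.sum_congr rfl fun j _ => Finset.sum_congr rfl fun k _ => ?_)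
    rw [two_pow_two_mul_add, kummerBesselCoeff, kummerBesselCoeff, srivastavaDaoust]
    ring
  · have hW : ∀ d e : ℂ, Summable fun N => ‖poch d N / poch e N‖ * (3 * ‖x‖ + 1) ^ N / (N ! : ℝ) :=
      fun d e => summable_poch_div_poch_mul_pow d e (by positivity)
    have s1 : Summable
        (kampeDeFerietTerm [d] [α] [β + n] [e] [2 * α + m] [2 * β + n] x (-x)) := by
      refine (summable_weight_coeff_coeff (hW d e) (by linarith [norm_nonneg x]) k1 k3).congr
        fun p => ?_
      rw [kampeDeFerietTerm_neg_eq, hE]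
    have s2 : Summable (srivastavaF3Term ⟨[d], [], [], [], [], [α], [β]⟩
        ⟨[e], [], [], [], [], [2 * α + m], [2 * β + n]⟩ (-x) x x) := by
      refine (summable_weight_coeff_coeff_coeff (hW d e) (lt_add_one _)
        expType_exp.rescale_neg_one k1 k2).congr fun p => ?_
      rw [srivastavaF3Term_eq, hE]
    have s3 : ∀ j ≤ m, ∀ k ≤ n, Summable (pFqTerm
        [(α + β + j + k) / 2, (α + β + j + k + 1) / 2, (d + j + k) / 2, (d + j + k + 1) / 2]
        [α + j + 1 / 2, β + k + 1 / 2, α + β + j + k, (e + j + k) / 2, (e + j + k + 1) / 2]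
        (x ^ 2 / 4)) := by
      intro j _ k _
      refine (summable_weight_besselProd (hW (d + j + k) (e + j + k))
        (by linarith [norm_nonneg x]) (α + j + 1 / 2) (β + k + 1 / 2)
        (α + β + j + k)).congr fun p => ?_
      rw [pFqTerm_four_five_eq]
    refine ⟨s1, s2, s3, kampeDeFeriet_eq_srivastavaF3 m hβ [e] d α x s1 s2, ?_⟩
    have h := hasSum_weight_sum (hV e)
      (kummerSeries_mul_rescale_kummerSeries_eq_sum hα hβ hα' hβ' hαβ hα₀ hβ₀)
      (hasSum_coeff_mul (W := fun N => poch d N / poch e N)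
        (fun p => by rw [kampeDeFerietTerm_neg_eq, hE]) s1.hasSum)
      (fun j hj k hk => hasSum_coeff_evenSeries
        (fun p => by rw [pFqTerm_four_five_eq]; simp only [hcast]) (s3 j hj k hk).hasSum)
    refine h.trans (Finset.sum_congr rfl fun j _ => Finset.sum_congr rfl fun k _ => ?_)
    rw [two_pow_two_mul_add, kummerBesselCoeff, kummerBesselCoeff, pFq]
    ring
  · refine ⟨fun hx => ?_, fun s1 s2 => ?_⟩
    -- Without `e` the weights require t < 1, while double series require 2‖x‖ < t.
    · obtain ⟨t, ht, ht1⟩ := exists_between (show 2 * ‖x‖ < 1 by linarith)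
      have ht0 : 0 ≤ t := by linarith [norm_nonneg x]
      refine ⟨?_, fun j _ k _ => ?_⟩
      · refine (summable_weight_coeff_coeff (summable_poch_mul_pow d ht0 ht1) ht k1 k2).congr
          fun p => ?_
        rw [kampeDeFerietTerm_eq, hE₀, div_one]
      · refine (summable_weight_exp_besselProd (summable_poch_mul_pow (d + j + k) ht0 ht1) ht
          (α + j + 1 / 2) (β + k + 1 / 2)
        (α + β + j + k)).congr fun p => ?_
        rw [srivastavaDaoustTerm_eq, hE₀', div_one]
    · have h := hasSum_weight_sum hV₀
        (kummerSeries_mul_kummerSeries_eq_sum hα hβ hα' hβ' hαβ hα₀ hβ₀)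
        (hasSum_coeff_mul (W := fun N => poch d N)
          (fun p => by rw [kampeDeFerietTerm_eq, hE₀, div_one]) s1.hasSum)
        (fun j hj k hk => hasSum_coeff_mul_evenSeries
          (fun p => by rw [srivastavaDaoustTerm_eq, hE₀', div_one]; simp only [hcast]) (s2 j hj k hk).hasSum)
      refine h.trans (Finset.sum_congr rfl fun j _ => Finset.sum_congr rfl fun k _ => ?_)
      rw [two_pow_two_mul_add, kummerBesselCoeff, kummerBesselCoeff, srivastavaDaoust]
      ring
  · refine ⟨fun hx => ?_, fun hx => ?_, kampeDeFeriet_eq_srivastavaF3 m hβ [] d α x,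
      fun s1 s3 => ?_⟩
    · obtain ⟨t, ht, ht1⟩ := exists_between (show 2 * ‖x‖ < 1 by linarith)
      have ht0 : 0 ≤ t := by linarith [norm_nonneg x]
      refine ⟨?_, fun j _ k _ => ?_⟩
      · refine (summable_weight_coeff_coeff (summable_poch_mul_pow d ht0 ht1) ht k1 k3).congr
          fun p => ?_
        rw [kampeDeFerietTerm_neg_eq, hE₀, div_one]
      · refine (summable_weight_besselProd (summable_poch_mul_pow (d + j + k) ht0 ht1)
          (by linarith [norm_nonneg x]) (α + j + 1 / 2) (β + k + 1 / 2)
        (α + β + j + k)).congr fun p => ?_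
        rw [pFqTerm_four_three_eq]
    · obtain ⟨t, ht, ht1⟩ := exists_between (show 3 * ‖x‖ < 1 by linarith)
      have ht0 : 0 ≤ t := by linarith [norm_nonneg x]
      refine (summable_weight_coeff_coeff_coeff (summable_poch_mul_pow d ht0 ht1) ht
        expType_exp.rescale_neg_one k1 k2).congr fun p => ?_
      rw [srivastavaF3Term_eq, hE₀, div_one]
    · have h := hasSum_weight_sum hV₀
        (kummerSeries_mul_rescale_kummerSeries_eq_sum hα hβ hα' hβ' hαβ hα₀ hβ₀)
        (hasSum_coeff_mul (W := fun N => poch d N)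
          (fun p => by rw [kampeDeFerietTerm_neg_eq, hE₀, div_one]) s1.hasSum)
        (fun j hj k hk => hasSum_coeff_evenSeries
          (fun p => by rw [pFqTerm_four_three_eq]; simp only [hcast]) (s3 j hj k hk).hasSum)
      refine h.trans (Finset.sum_congr rfl fun j _ => Finset.sum_congr rfl fun k _ => ?_)
      rw [two_pow_two_mul_add, kummerBesselCoeff, kummerBesselCoeff, pFq]
      ring
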